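/- Let $N\ge 2$, $\mathbf p\in[2,\infty)$, $s\in(\tfrac12,1)$. **The game.** Let $\alpha_{\mathbf p}\in(0,\frac{\pi}{2}]$ be the angle for which the spherical cap $A_{\mathbf p}=\{|z|=1,\ \angle(e_1,z)<\alpha_{\mathbf p}\}$ satisfies $\mathbf p-1=\int_{A_{\mathbf p}}\langle z,e_1\rangle^2\,d\sigma\big/\int_{A_{\mathbf p}}\langle z,e_2\rangle^2\,d\sigma$, where $\sigma$ is the surface measure of the unit sphere, and put $T=\{z\in\mathbb R^N:\ \angle(e_1,z)<\alpha_{\mathbf p},\ |z|>1\}$. Let $d\mu_s^N(z)=C(N,s)|z|^{-N-2s}\,dz$ with $C(N,s)=\frac{4^s s\Gamma(N/2+s)}{\pi^{N/2}\Gamma(1-s)}$. Let $\Omega_1=T\times\{1,2\}$ carry the product of the normalised measure $\mu_s^N/\mu_s^N(T)$ and the uniform measure on $\{1,2\}$, and let $(\Omega,\mathbb P)$ be the countable product of copies of $\Omega_1$, with elements $\omega=\{(z_i,s_i)\}_{i\ge1}$. A strategy is a sequence $\sigma=\{\sigma^n\}_{n\ge 0}$ of Borel maps $\sigma^n:\mathbb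 R^N\times(\mathbb R^N\times\Omega_1)^n\to\{|y|=1\}$. For a unit vector $y$ let $R_y\in SO(N)$ be the rotation in the plane of $e_1$ and $y$ with $R_ye_1=y$ ($R_{e_1}=\mathrm{Id}$; $R_{-e_1}$ is the half-turn in the plane of $e_1,e_2$). Given $\epsilon>0$, a starting point $x_0\in\mathbb R^N$ and strategies $\sigma_I,\sigma_{II}$, define $X_0=x_0$ and $$X_n=X_{n-1}+\epsilon R_{y_n}z_n,\qquad y_n=\begin{cases}\sigma_I^{n-1}(h_{n-1})& \text{if } s_n=1,\\ \sigma_{II}^{n-1}(h_{n-1})& \text{if } s_n=2,\end{cases}\qquad h_n=\big(X_0,(X_1,z_1,s_1),\ldots,(X_n,z_n,s_n)\big).$$ For a set $\mathcal D\subset\mathbb R^N$ let $\tau=\min\{n\ge1:\ X_n\notin\mathcal D\}$ (with $\tau=\infty$ if there is no such $n$). **Theorem.** Let $\mathcal D\subset\mathbb R^N$ be open, bounded, and satisfy the exterior cone condition: there is a finite cone $C=\{z:\ \angle(e_1,z)<\beta,\ 0<|z|<h\}$, with $\beta\in(0,\frac\pi2]$ and $h>0$, such that for each $x\in\partial\mathcal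 D$ there is a rotation $S_x\in SO(N)$ with $x+S_xC\subset\mathbb R^N\setminus\mathcal D$. Then every $x\in\partial\mathcal D$ is game-regular: for all $\xi,\delta>0$ there exist $\hat\delta,\hat\epsilon>0$ such that for every $\epsilon\in(0,\hat\epsilon)$ and every $\bar x\in B_{\hat\delta}(x)\cap\mathcal D$ there is a strategy $\sigma_I$ of Player I such that, for every strategy $\sigma_{II}$ of Player II, the game started at $x_0=\bar x$ satisfies $$\mathbb P\big(\tau<\infty\ \text{ and }\ X_\tau\in B_\delta(x)\big)\ \ge\ 1-\xi.$$ -/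

import Mathlib

noncomputable section

namespace TugOfWar

open MeasureTheory ProbabilityTheory Metric Set
open scoped ENNReal RealInnerProductSpace

/-- The Euclidean space `ℝ^N`. -/
abbrev E (N : ℕ) : Type := EuclideanSpace ℝ (Fin N)

/-- The first vector of the canonical basis. -/
def e₁ (N : ℕ) [N.AtLeastTwo] : E N := EuclideanSpace.single 0 1

/-- The second vector of the canonical basis. -/
def e₂ (N : ℕ) [N.AtLeastTwo] : E N := EuclideanSpace.single 1 1

/-! ### The cone `T_p` and the measure `μ_s^N` -/

/-- The spherical cap `A(α) = {|z| = 1, ∠(e₁, z) < α}`. -/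
def cap (N : ℕ) [N.AtLeastTwo] (α : ℝ) : Set (sphere (0 : E N) 1) :=
  {z | InnerProductGeometry.angle (e₁ N) z < α}

/-- The ratio `∫_{A(α)} ⟨z, e₁⟩² dσ / ∫_{A(α)} ⟨z, e₂⟩² dσ`, where `σ` is the surface measure
of the unit sphere. -/
def capRatio (N : ℕ) [N.AtLeastTwo] (α : ℝ) : ℝ :=
  (∫ z in cap N α, ⟪(z : E N), e₁ N⟫ ^ 2 ∂(volume : Measure (E N)).toSphere) /
    (∫ z in cap N α, ⟪(z : E N), e₂ N⟫ ^ 2 ∂(volume : Measure (E N)).toSphere)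

/-- The aperture angle `α_p`: the solution `α ∈ (0, π/2]` of `p - 1 = capRatio N α`.
The ratio decreases strictly and continuously from `∞` to `1` on `(0, π/2]`, so that for
`p ≥ 2` the set below has exactly one element, and `sSup` selects it. -/
def coneAngle (N : ℕ) [N.AtLeastTwo] (p : ℝ) : ℝ :=
  sSup {α | α ∈ Ioc 0 (Real.pi / 2) ∧ p - 1 = capRatio N α}

/-- The truncated infinite cone `T_p^{a,∞}(y) = {z; ∠(y, z) < α_p, a < |z|}`. -/
def truncCone (N : ℕ) [N.AtLeastTwo] (p a : ℝ) (y : E N) : Set (E N) :=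
  {z | InnerProductGeometry.angle y z < coneAngle N p ∧ a < ‖z‖}

/-- The constant `C(N,s) = 4^s s Γ(N/2 + s) / (π^{N/2} Γ(1 - s))`. -/
def fracConst (N : ℕ) (s : ℝ) : ℝ :=
  (4 : ℝ) ^ s * s * Real.Gamma ((N : ℝ) / 2 + s) /
    (Real.pi ^ ((N : ℝ) / 2) * Real.Gamma (1 - s))

/-- The measure `dμ_s^N(z) = C(N,s) |z|^{-N-2s} dz`. -/
def fracMeasure (N : ℕ) (s : ℝ) : Measure (E N) :=
  volume.withDensity fun z => ENNReal.ofReal (fracConst N s / ‖z‖ ^ ((N : ℝ) + 2 * s))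

/-- The rotation `R_{y, e₁} ∈ SO(N)` in the plane of `e₁` and `y` that carries `e₁` to the unit
vector `y`, written as the product of the reflections in the hyperplanes orthogonal to `e₁` and
to `e₁ + y`. For `y = e₁` it is the identity. For `y = -e₁`, where the plane is not determined,
the half-turn in the plane of `e₁` and `e₂` is taken. -/
def dirRotation (N : ℕ) [N.AtLeastTwo] (y : E N) : E N ≃ₗᵢ[ℝ] E N :=
  open Classical in
  ((ℝ ∙ e₁ N)ᗮ.reflection).trans
    ((ℝ ∙ (if y = -e₁ N then e₂ N else e₁ N + y))ᗮ.reflection)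

/-! ### The probability space -/

/-- One random outcome: `Ω₁ = T_p^{1,∞} × {1, 2}`. The value `true` of the second component
activates Player I, the value `false` activates Player II. -/
abbrev Outcome (N : ℕ) [N.AtLeastTwo] (p : ℝ) : Type :=
  truncCone N p 1 (e₁ N) × Bool

/-- The measure `μ_s^N` on `T_p^{1,∞}`, normalised to a probability measure. -/
def jumpLaw (N : ℕ) [N.AtLeastTwo] (p s : ℝ) : Measure (truncCone N p 1 (e₁ N)) :=
  (fracMeasure N s (truncCone N p 1 (e₁ N)))⁻¹ • (fracMeasure N s).comap Subtype.val

/-- The law `ℙ₁` of one outcome: product of `jumpLaw` with a fair coin. -/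
def outcomeLaw (N : ℕ) [N.AtLeastTwo] (p s : ℝ) : Measure (Outcome N p) :=
  (jumpLaw N p s).prod (uniformOn univ)

/-- The countable product `ℙ` of the laws `ℙ₁`; the `n`-th coordinate (`n = 0, 1, …`) of the
sample point is `(z_{n+1}, s_{n+1})`. -/
def gameMeasure (N : ℕ) [N.AtLeastTwo] (p s : ℝ) : Measure (ℕ → Outcome N p) :=
  Measure.infinitePi fun _ => outcomeLaw N p s

/-! ### Strategies and the game process -/

/-- Finite histories `H_n = ℝ^N × (ℝ^N × Ω₁)^n`, listing
`x₀, (x₁, z₁, s₁), …, (x_n, z_n, s_n)`. -/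
abbrev History (N : ℕ) [N.AtLeastTwo] (p : ℝ) (n : ℕ) : Type :=
  E N × (Fin n → E N × Outcome N p)

/-- The current position `x_n` recorded in a history of length `n`. -/
def History.last {N : ℕ} [N.AtLeastTwo] {p : ℝ} : {n : ℕ} → History N p n → E N
  | 0, h => h.1
  | n + 1, h => (h.2 (Fin.last n)).1

/-- A strategy: a sequence of Borel measurable maps from histories to unit vectors. -/
structure Strategy (N : ℕ) [N.AtLeastTwo] (p : ℝ) where
  /-- The direction chosen after a history of length `n`. -/
  move : (n : ℕ) → History N p n → sphere (0 : E N) 1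
  measurable_move : ∀ n, Measurable (move n)

/-- The history of the first `n` rounds of the game with parameter `ε`, started at `x`. -/
def gameHistory {N : ℕ} [N.AtLeastTwo] {p : ℝ} (ε : ℝ) (x : E N) (σI σII : Strategy N p) :
    (n : ℕ) → (ℕ → Outcome N p) → History N p n
  | 0, _ => (x, Fin.elim0)
  | n + 1, ω =>
    let h := gameHistory ε x σI σII n ω
    let y : sphere (0 : E N) 1 := if (ω n).2 then σI.move n h else σII.move n h
    (x, Fin.snoc h.2 (h.last + ε • dirRotation N (y : E N) ((ω n).1 : E N), ω n))

/-- The game position `X_n^{ε, x, σI, σII}`. -/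
def position {N : ℕ} [N.AtLeastTwo] {p : ℝ} (ε : ℝ) (x : E N) (σI σII : Strategy N p)
    (n : ℕ) (ω : ℕ → Outcome N p) : E N :=
  (gameHistory ε x σI σII n ω).last

/-- The exit time `τ = min {n ≥ 1; X_n ∉ D}`, with value `⊤` if there is no such `n`. -/
def exitTime {N : ℕ} [N.AtLeastTwo] {p : ℝ} (D : Set (E N)) (ε : ℝ) (x : E N)
    (σI σII : Strategy N p) : (ℕ → Outcome N p) → WithTop ℕ :=
  hittingAfter (position ε x σI σII) Dᶜ 1

/-- The exit position `X_τ` (meaningful on the event `τ < ⊤`). -/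
def exitPosition {N : ℕ} [N.AtLeastTwo] {p : ℝ} (D : Set (E N)) (ε : ℝ) (x : E N)
    (σI σII : Strategy N p) : (ℕ → Outcome N p) → E N :=
  stoppedValue (position ε x σI σII) (exitTime D ε x σI σII)

/-! ### Game-regularity and the exterior cone condition -/

/-- Game-regularity of the point `x`: for all `ξ, δ > 0`, whenever `ε` is small enough and the
starting point `x'` in `D` is close enough to `x`, Player I has a strategy such that, against
every strategy of Player II, the game ends and its exit position lies in `B_δ(x)` with
probability at least `1 - ξ`. -/
def GameRegular {N : ℕ} [N.AtLeastTwo] (p s : ℝ) (D : Set (E N)) (x : E N) : Prop :=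
  ∀ ξ > (0 : ℝ), ∀ δ > (0 : ℝ), ∃ δ' > (0 : ℝ), ∃ ε' > (0 : ℝ),
    ∀ ε, 0 < ε → ε < ε' → ∀ x' ∈ ball x δ' ∩ D,
      ∃ σI : Strategy N p, ∀ σII : Strategy N p,
        1 - ξ ≤ (gameMeasure N p s).real
          {ω | exitTime D ε x' σI σII ω < ⊤ ∧ exitPosition D ε x' σI σII ω ∈ ball x δ}

/-- The finite cone of half-aperture `β` and height `h`, with vertex `0` and axis `e₁`. -/
def finiteCone (N : ℕ) [N.AtLeastTwo] (β h : ℝ) : Set (E N) :=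
  {z | InnerProductGeometry.angle (e₁ N) z < β ∧ 0 < ‖z‖ ∧ ‖z‖ < h}

/-- The exterior cone condition: a rotated copy of one fixed finite cone, with its vertex placed
at any boundary point of `D`, stays outside `D`. -/
def ExteriorConeCondition {N : ℕ} [N.AtLeastTwo] (D : Set (E N)) : Prop :=
  ∃ β ∈ Ioc 0 (Real.pi / 2), ∃ h > (0 : ℝ), ∀ x ∈ frontier D,
    ∃ S : E N ≃ₗᵢ[ℝ] E N, LinearMap.det (S.toLinearEquiv : E N →ₗ[ℝ] E N) = 1 ∧
      ∀ z ∈ finiteCone N β h, x + S z ∉ D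

end TugOfWar

end

noncomputable section

namespace TugOfWar

open MeasureTheory ProbabilityTheory Metric Set
open scoped ENNReal RealInnerProductSpace Pointwise

/-! ### Angles and cones -/

/-! Player I wins by means of a barrier that is a supermartingale whatever Player II does. Let `e`
be the axis of the exterior cone at `x₀`, let `v = x₀ + r • e` be a point slightly inside the cone,
and let `G` be the value of `coneGauge e` at the position relative to `v`. The level sphere through
the current position has radius `2G/3` and centre `v + (G/3) • e`. This centre lies on the axis of
the cone, and Player I always pulls towards it.

Consider `(G / M) ^ γ`. The gradient of `G` is a nonpositive multiple of the pulling direction, and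
the mean jump is a fixed nonnegative multiple of the direction chosen by the active player
(`exists_integral_jumpLaw`). To first order, then, Player I at least cancels the worst drift of
Player II. The remaining error is at most a constant times `γ (ε/G)^(2s)`, by
`exists_coneGauge_add_le` and the scaling bound `exists_integral_sqMin_le`. It is paid for by the
heavy tail of the jumps: with probability at least a constant times `(ε/G)^(2s)`, a single jump of
Player I lands in a ball about the centre, of radius proportional to `G` (`exists_jumpLaw_ball_ge`).
For `G < M` that ball lies outside `D` and inside `B_δ(x₀)`, so the barrier may be set to zero
there. Error and gain have the same exponent, but the gain carries no factor `γ`; a small `γ`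
therefore gives the supermartingale inequality at all scales `G ≥ 3ε` (`integral_barrier_le`).

The barrier equals `1` off `B_δ(x₀)`, so an exit elsewhere has probability at most its initial
value, which is small near `x₀` (`one_sub_le_of_barrier`). The game ends almost surely because long
jumps occur (`gameMeasure_forall_mem`). Shifting the vertex by `r` keeps `G ≥ κ₀ r` on `D`, so `3ε ≤
G` holds throughout once `ε` is small. The parameter `p` enters only through `coneAngle N p ∈ (0,
π/2]`. -/

/-- A ball centred on the axis of a cone, with radius proportional to the distance to the vertex,
lies in the cone. -/
lemma exists_forall_angle_add_lt {F : Type*} [NormedAddCommGroup F] [InnerProductSpace ℝ F] {β : ℝ}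
    (hβ : β ∈ Ioc 0 (Real.pi / 2)) :
    ∃ κ : ℝ, 0 < κ ∧ κ ≤ 1 / 4 ∧ ∀ (e p : F) (r : ℝ), ‖e‖ = 1 → 0 < r → ‖p‖ ≤ κ * r →
      InnerProductGeometry.angle e (r • e + p) < β := by
  have hcos0 : 0 ≤ Real.cos β :=
    Real.cos_nonneg_of_mem_Icc ⟨by linarith [hβ.1, Real.pi_pos], hβ.2⟩
  have hcos1 : Real.cos β < 1 := by
    have := Real.cos_lt_cos_of_nonneg_of_le_pi_div_two le_rfl hβ.2 hβ.1
    simpa using this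
  -- With this `κ` the cosine of the angle is at least `(1 - κ) / (1 + κ)`, which exceeds `cos β`.
  refine ⟨(1 - Real.cos β) / 4, by linarith, by linarith, fun e p r he hr hp ↦ ?_⟩
  set κ := (1 - Real.cos β) / 4 with hκ
  have hκ4 : κ ≤ 1 / 4 := by linarith
  have hip : |⟪e, p⟫| ≤ ‖p‖ := by simpa [he] using abs_real_inner_le_norm e p
  have hinner : (1 - κ) * r ≤ ⟪e, r • e + p⟫ := by
    rw [inner_add_right, inner_smul_right, real_inner_self_eq_norm_sq, he]
    linarith [(abs_le.mp hip).1]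
  have hnorm : ‖r • e + p‖ ≤ (1 + κ) * r := by
    refine (norm_add_le _ _).trans ?_
    rw [norm_smul, he, Real.norm_of_nonneg hr.le]
    linarith
  have hpos : 0 < ⟪e, r • e + p⟫ := lt_of_lt_of_le (by nlinarith) hinner
  have hnpos : 0 < ‖r • e + p‖ := by
    rw [norm_pos_iff]
    rintro h
    simp [h] at hpos
  rw [InnerProductGeometry.angle, he, one_mul]
  have hlt : Real.cos β < ⟪e, r • e + p⟫ / ‖r • e + p‖ := by
    rw [lt_div_iff₀ hnpos]
    have h1 : Real.cos β * ‖r • e + p‖ ≤ Real.cos β * ((1 + κ) * r) := by gcongr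
    have h2 : Real.cos β * (1 + κ) < 1 - κ := by nlinarith
    nlinarith
  have hle : ⟪e, r • e + p⟫ / ‖r • e + p‖ ≤ 1 := by
    rw [div_le_one hnpos]
    simpa [he] using real_inner_le_norm e (r • e + p)
  rw [← Real.arccos_cos hβ.1.le (by linarith [hβ.2, Real.pi_pos])]
  exact Real.strictAntiOn_arccos ⟨by linarith, hcos1.le⟩ ⟨by linarith, hle⟩ hlt

lemma norm_e₁ (N : ℕ) [N.AtLeastTwo] : ‖e₁ N‖ = 1 := by simp [e₁]

lemma inner_e₁ {N : ℕ} [N.AtLeastTwo] (z : E N) : ⟪z, e₁ N⟫ = z 0 := by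
  simp [e₁, EuclideanSpace.inner_single_right]

lemma inner_e₂ {N : ℕ} [N.AtLeastTwo] (z : E N) : ⟪z, e₂ N⟫ = z 1 := by
  simp [e₂, EuclideanSpace.inner_single_right]

lemma zero_ne_one_fin {N : ℕ} [h : N.AtLeastTwo] : (0 : Fin N) ≠ 1 := by
  have := h.prop
  rw [Ne, Fin.ext_iff, Fin.val_zero, Fin.val_one', Nat.mod_eq_of_lt (by lia)]
  exact zero_ne_one

lemma measurable_angle_e₁ (N : ℕ) [N.AtLeastTwo] :
    Measurable fun z : E N ↦ InnerProductGeometry.angle (e₁ N) z := by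
  unfold InnerProductGeometry.angle
  exact Real.continuous_arccos.measurable.comp
    (Measurable.div (by fun_prop) (by fun_prop))

/-! ### The aperture angle -/

/-- The action of a linear isometry on the unit sphere. -/
def sphereMap {F : Type*} [NormedAddCommGroup F] [NormedSpace ℝ F] (L : F ≃ₗᵢ[ℝ] F)
    (z : sphere (0 : F) 1) : sphere (0 : F) 1 :=
  ⟨L z, by simp⟩

lemma measurePreserving_sphereMap {F : Type*} [NormedAddCommGroup F] [InnerProductSpace ℝ F]
    [FiniteDimensional ℝ F] [MeasurableSpace F] [BorelSpace F] (L : F ≃ₗᵢ[ℝ] F) :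
    MeasurePreserving (sphereMap L) (volume : Measure F).toSphere (volume : Measure F).toSphere := by
  have hm : Measurable (sphereMap L) :=
    (L.continuous.measurable.comp measurable_subtype_coe).subtype_mk
  refine ⟨hm, Measure.ext fun s hs ↦ ?_⟩
  rw [Measure.map_apply hm hs, Measure.toSphere_apply' _ hs, Measure.toSphere_apply' _ (hm hs)]
  congr 1
  have hL : MeasurePreserving L.toHomeomorph.toMeasurableEquiv volume volume :=
    L.measurePreserving
  rw [← hL.measure_preimage_equiv (Ioo (0 : ℝ) 1 • (Subtype.val '' s))]
  congr 1
  ext z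
  simp only [mem_preimage, Set.mem_smul, mem_image, Subtype.exists]
  constructor
  · rintro ⟨r, hr, _, ⟨w, hw, hws, rfl⟩, rfl⟩
    exact ⟨r, hr, _, ⟨L w, by simpa using hw, hws, rfl⟩, by simp⟩
  · rintro ⟨r, hr, _, ⟨w, hw, hws, rfl⟩, h⟩
    refine ⟨r, hr, _, ⟨L.symm w, by simpa using hw, by simpa [sphereMap] using hws, rfl⟩, ?_⟩
    apply L.injective
    simpa using h

/-- The surface measure of a set is a multiple of the volume of the truncated radial cone over it.
Here that cone lies in the boundary of a convex circular cone, and the boundary of a convex set is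
null. -/
lemma toSphere_angle_eq (N : ℕ) [N.AtLeastTwo] {α : ℝ} (hα : α ∈ Ioc 0 (Real.pi / 2)) :
    (volume : Measure (E N)).toSphere
      {z | InnerProductGeometry.angle (e₁ N) (z : E N) = α} = 0 := by
  have hcos0 : 0 ≤ Real.cos α :=
    Real.cos_nonneg_of_mem_Icc ⟨by linarith [hα.1, Real.pi_pos], hα.2⟩
  have hcos1 : Real.cos α < 1 := by
    simpa using Real.cos_lt_cos_of_nonneg_of_le_pi_div_two le_rfl hα.2 hα.1
  have hms : MeasurableSet
      {z : sphere (0 : E N) 1 | InnerProductGeometry.angle (e₁ N) (z : E N) = α} :=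
    ((measurable_angle_e₁ N).comp measurable_subtype_coe) (measurableSet_singleton α)
  rw [Measure.toSphere_apply' _ hms]
  set K : Set (E N) := {z | Real.cos α * ‖z‖ ≤ ⟪e₁ N, z⟫}
  have hK : Convex ℝ K := by
    intro z hz w hw a b ha hb _
    simp only [K, mem_ofPred_eq] at *
    rw [inner_add_right, inner_smul_right, inner_smul_right]
    have : ‖a • z + b • w‖ ≤ a * ‖z‖ + b * ‖w‖ := by
      refine (norm_add_le _ _).trans ?_
      rw [norm_smul, norm_smul, Real.norm_of_nonneg ha, Real.norm_of_nonneg hb]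
    nlinarith [mul_le_mul_of_nonneg_left this hcos0]
  refine mul_eq_zero_of_right _ (measure_mono_null ?_ (hK.addHaar_frontier volume))
  rintro _ ⟨r, hr, _, ⟨z, hz, rfl⟩, rfl⟩
  have hzn : ‖(z : E N)‖ = 1 := by simp
  have hz1 : ⟪e₁ N, (z : E N)⟫ = Real.cos α := by
    rw [← hz, InnerProductGeometry.cos_angle, norm_e₁, hzn]; simp
  have hrn : ‖r • (z : E N)‖ = r := by
    rw [norm_smul, hzn, Real.norm_of_nonneg hr.1.le, mul_one]
  have hri : ⟪e₁ N, r • (z : E N)⟫ = r * Real.cos α := by rw [inner_smul_right, hz1]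
  change r • (z : E N) ∈ frontier K
  rw [frontier, mem_sdiff]
  refine ⟨subset_closure ?_, fun hInt ↦ ?_⟩
  · simp only [K, mem_ofPred_eq, hrn, hri]; linarith
  · obtain ⟨t, ht, hsub⟩ := Metric.isOpen_iff.mp isOpen_interior _ hInt
    -- Moving an interior point back along the axis would keep it in `K`; but the inner product
    -- drops by `t / 2`, the norm by at most `t / 2`, and `cos α < 1`.
    have hmem : r • (z : E N) - (t / 2) • e₁ N ∈ K := by
      refine interior_subset (hsub ?_)
      rw [mem_ball, dist_eq_norm, sub_sub_cancel_left, norm_neg, norm_smul, norm_e₁,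
        Real.norm_of_nonneg (by positivity)]
      linarith
    simp only [K, mem_ofPred_eq, inner_sub_right, hri, inner_smul_right,
      real_inner_self_eq_norm_sq, norm_e₁] at hmem
    have hge : r - t / 2 ≤ ‖r • (z : E N) - (t / 2) • e₁ N‖ := by
      have := norm_sub_norm_le (r • (z : E N)) ((t / 2) • e₁ N)
      rwa [hrn, norm_smul, norm_e₁, Real.norm_of_nonneg (by positivity), mul_one] at this
    nlinarith [mul_le_mul_of_nonneg_left hge hcos0]

lemma measurableSet_cap (N : ℕ) [N.AtLeastTwo] (α : ℝ) : MeasurableSet (cap N α) :=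
  ((measurable_angle_e₁ N).comp measurable_subtype_coe) measurableSet_Iio

/-- Dominated convergence: the indicator of the cap is locally constant in the angle at every `z`
off the bounding circle, which is null. -/
lemma continuousOn_setIntegral_cap (N : ℕ) [N.AtLeastTwo] {f : sphere (0 : E N) 1 → ℝ}
    (hf : Continuous f) :
    ContinuousOn (fun α ↦ ∫ z in cap N α, f z ∂(volume : Measure (E N)).toSphere)
      (Ioc 0 (Real.pi / 2)) := by
  intro α hα
  apply ContinuousAt.continuousWithinAt
  simp_rw [← integral_indicator (measurableSet_cap N _)]
  obtain ⟨C, hC⟩ := (isCompact_univ (X := sphere (0 : E N) 1)).exists_bound_of_continuousOn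
    hf.continuousOn
  refine continuousAt_of_dominated (bound := fun _ ↦ C) ?_ ?_ (integrable_const C) ?_
  · exact .of_forall fun x ↦ (hf.measurable.indicator (measurableSet_cap N x)).aestronglyMeasurable
  · refine .of_forall fun x ↦ .of_forall fun z ↦ ?_
    exact (norm_indicator_le_norm_self _ _).trans (hC z (mem_univ _))
  · have : ∀ᵐ z : sphere (0 : E N) 1 ∂(volume : Measure (E N)).toSphere,
        InnerProductGeometry.angle (e₁ N) (z : E N) ≠ α := by
      rw [ae_iff]
      simpa using toSphere_angle_eq N hα
    filter_upwards [this] with z hz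
    rcases lt_or_gt_of_ne hz with h | h
    · refine (continuousAt_const (y := f z)).congr ?_
      filter_upwards [lt_mem_nhds h] with x hx
      rw [indicator_of_mem]
      exact hx
    · refine (continuousAt_const (y := (0 : ℝ))).congr ?_
      filter_upwards [gt_mem_nhds h] with x hx
      rw [indicator_of_notMem]
      exact not_lt.mpr (le_of_lt hx)

/-- Swapping the first two coordinates makes the integral over the whole sphere vanish, and the
antipodal map splits it into two equal halves. -/
lemma setIntegral_cap_pi_div_two (N : ℕ) [N.AtLeastTwo] :
    ∫ z in cap N (Real.pi / 2), ((z : E N) 0 ^ 2 - (z : E N) 1 ^ 2)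
      ∂(volume : Measure (E N)).toSphere = 0 := by
  set μ := (volume : Measure (E N)).toSphere
  set f : sphere (0 : E N) 1 → ℝ := fun z ↦ (z : E N) 0 ^ 2 - (z : E N) 1 ^ 2
  have hfc : Continuous f := by fun_prop
  have hfi : Integrable f μ := by
    simpa using hfc.continuousOn.integrableOn_compact (μ := μ) isCompact_univ
  have htot : ∫ z, f z ∂μ = 0 := by
    have hswap := (measurePreserving_sphereMap (LinearIsometryEquiv.piLpCongrLeft 2 ℝ ℝ
      (Equiv.swap (0 : Fin N) 1))).integral_comp' (f := MeasurableEquiv.ofInvolutive _ (by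
        intro z; ext i; simp [sphereMap, LinearIsometryEquiv.piLpCongrLeft_apply,
          Equiv.piCongrLeft']) (measurePreserving_sphereMap _).measurable) f
    have hneg : ∀ z, f (sphereMap (LinearIsometryEquiv.piLpCongrLeft 2 ℝ ℝ
        (Equiv.swap (0 : Fin N) 1)) z) = - f z := by
      intro z
      simp [f, sphereMap, LinearIsometryEquiv.piLpCongrLeft_apply, Equiv.piCongrLeft']
    have : ∫ z, -f z ∂μ = ∫ z, f z ∂μ := by
      rw [← hswap]
      exact integral_congr_ae (.of_forall fun z ↦ (hneg z).symm)
    rw [integral_neg] at this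
    linarith
  have hnegInt : ∫ z in (cap N (Real.pi / 2))ᶜ, f z ∂μ = ∫ z in cap N (Real.pi / 2), f z ∂μ := by
    have hmp := measurePreserving_sphereMap (LinearIsometryEquiv.neg ℝ (E := E N))
    have hemb : MeasurableEmbedding (sphereMap (LinearIsometryEquiv.neg ℝ (E := E N))) :=
      (MeasurableEquiv.ofInvolutive _ (by intro z; ext i; simp [sphereMap])
        hmp.measurable).measurableEmbedding
    have h1 := hmp.setIntegral_preimage_emb hemb f (cap N (Real.pi / 2))
    rw [← h1]
    have h2 : ∀ z, f (sphereMap (LinearIsometryEquiv.neg ℝ (E := E N)) z) = f z := by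
      intro z; simp [f, sphereMap]
    simp_rw [h2]
    refine setIntegral_congr_set ?_
    have : ∀ᵐ z : sphere (0 : E N) 1 ∂μ,
        InnerProductGeometry.angle (e₁ N) (z : E N) ≠ Real.pi / 2 := by
      rw [ae_iff]
      simpa using toSphere_angle_eq N (α := Real.pi / 2) ⟨by positivity, le_rfl⟩
    filter_upwards [this] with z hz
    rw [eq_iff_iff]
    change ¬ (InnerProductGeometry.angle (e₁ N) (z : E N) < Real.pi / 2) ↔
      InnerProductGeometry.angle (e₁ N) (-(z : E N)) < Real.pi / 2
    rw [InnerProductGeometry.angle_neg_right]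
    constructor
    · intro h
      have := lt_of_le_of_ne (not_lt.mp h) hz.symm
      linarith
    · intro h; linarith
  have := integral_add_compl (measurableSet_cap N (Real.pi / 2)) hfi
  rw [hnegInt, htot] at this
  linarith

/-- Intermediate value theorem for `g`, the numerator minus `p - 1` times the denominator. At `π /
2` the two integrals agree and `p - 1 ≥ 1`; on a small cap `z₀² ≥ (p - 1) / p`, which forces `z₁² ≤
1 / p`. -/
lemma exists_eq_capRatio (N : ℕ) [N.AtLeastTwo] {p : ℝ} (hp : 2 ≤ p) :
    ∃ α ∈ Ioc 0 (Real.pi / 2), p - 1 = capRatio N α := by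
  set μ := (volume : Measure (E N)).toSphere
  set g : ℝ → ℝ := fun α ↦ ∫ z in cap N α, ((z : E N) 0 ^ 2 - (p - 1) * (z : E N) 1 ^ 2) ∂μ
  have hInt : ∀ {f : sphere (0 : E N) 1 → ℝ}, Continuous f → ∀ s, IntegrableOn f s μ := by
    intro f hf s
    exact (hf.continuousOn.integrableOn_compact (μ := μ) isCompact_univ).mono_set (subset_univ s)
  have hc1 : Continuous fun z : sphere (0 : E N) 1 ↦ (z : E N) 0 ^ 2 := by fun_prop
  have hc2 : Continuous fun z : sphere (0 : E N) 1 ↦ (z : E N) 1 ^ 2 := by fun_prop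
  have hsum : ∀ z : sphere (0 : E N) 1, (z : E N) 0 ^ 2 + (z : E N) 1 ^ 2 ≤ 1 := by
    intro z
    have hz : ‖(z : E N)‖ ^ 2 = 1 := by simp
    rw [EuclideanSpace.real_norm_sq_eq] at hz
    refine le_of_le_of_eq ?_ hz
    rw [← Finset.sum_pair (f := fun i ↦ (z : E N) i ^ 2) zero_ne_one_fin]
    exact Finset.sum_le_sum_of_subset_of_nonneg (Finset.subset_univ _) fun _ _ _ ↦ sq_nonneg _
  have hcosz : ∀ z : sphere (0 : E N) 1,
      Real.cos (InnerProductGeometry.angle (e₁ N) (z : E N)) = (z : E N) 0 := by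
    intro z
    rw [InnerProductGeometry.cos_angle, norm_e₁, real_inner_comm, inner_e₁]; simp
  have hgc : ContinuousOn g (Ioc 0 (Real.pi / 2)) := continuousOn_setIntegral_cap N (by fun_prop)
  have hend : g (Real.pi / 2) ≤ 0 := by
    rw [← setIntegral_cap_pi_div_two N]
    refine setIntegral_mono (hInt (by fun_prop) _) (hInt (by fun_prop) _) fun z ↦ ?_
    nlinarith [sq_nonneg ((z : E N) 1)]
  -- at the small angle `α₀` the integrand is nonnegative
  set α₀ := Real.arccos (Real.sqrt ((p - 1) / p)) with hα₀
  have hq0 : 0 < (p - 1) / p := by apply div_pos <;> linarith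
  have hq1 : (p - 1) / p < 1 := by rw [div_lt_one (by linarith)]; linarith
  have hα₀pos : 0 < α₀ := by
    rw [hα₀, Real.arccos_pos]
    rw [Real.sqrt_lt' one_pos]; simpa using hq1
  have hα₀le : α₀ ≤ Real.pi / 2 := Real.arccos_le_pi_div_two.mpr (Real.sqrt_nonneg _)
  have hstart : 0 ≤ g α₀ := by
    refine setIntegral_nonneg (measurableSet_cap N _) fun z hz ↦ ?_
    have hcos : Real.sqrt ((p - 1) / p) ≤ (z : E N) 0 := by
      rw [← hcosz z, ← Real.cos_arccos (x := Real.sqrt ((p - 1) / p))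
        (by linarith [Real.sqrt_nonneg ((p - 1) / p)]) (Real.sqrt_le_one.mpr hq1.le)]
      exact Real.cos_le_cos_of_nonneg_of_le_pi (InnerProductGeometry.angle_nonneg _ _)
        (by linarith [Real.pi_pos]) (le_of_lt hz)
    have hsq : (p - 1) / p ≤ (z : E N) 0 ^ 2 := by
      rw [← Real.sq_sqrt hq0.le]
      exact pow_le_pow_left₀ (Real.sqrt_nonneg _) hcos 2
    rw [div_le_iff₀ (by linarith)] at hsq
    nlinarith [hsum z]
  obtain ⟨α, hα, hα0⟩ := intermediate_value_Icc' hα₀le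
    (hgc.mono fun x hx ↦ ⟨hα₀pos.trans_le hx.1, hx.2⟩) ⟨hend, hstart⟩
  have hαmem : α ∈ Ioc 0 (Real.pi / 2) := ⟨hα₀pos.trans_le hα.1, hα.2⟩
  refine ⟨α, hαmem, ?_⟩
  simp only [capRatio, inner_e₁, inner_e₂]
  have heq : ∫ z in cap N α, (z : E N) 0 ^ 2 ∂μ = (p - 1) * ∫ z in cap N α, (z : E N) 1 ^ 2 ∂μ := by
    simp only [g] at hα0
    rw [integral_sub (hInt hc1 _) ((hInt hc2 _).const_mul _), integral_const_mul] at hα0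
    linarith
  have hpos : 0 < ∫ z in cap N α, (z : E N) 0 ^ 2 ∂μ := by
    rw [setIntegral_pos_iff_support_of_nonneg_ae (.of_forall fun z ↦ sq_nonneg _) (hInt hc1 _)]
    have hsub : cap N α ⊆ (Function.support fun z : sphere (0 : E N) 1 ↦ (z : E N) 0 ^ 2) ∩
        cap N α := by
      refine fun z hz ↦ ⟨?_, hz⟩
      rw [Function.mem_support, ← hcosz z]
      refine pow_ne_zero _ (ne_of_gt (Real.cos_pos_of_mem_Ioo ⟨?_, lt_of_lt_of_le hz hαmem.2⟩))
      linarith [Real.pi_pos, InnerProductGeometry.angle_nonneg (e₁ N) (z : E N)]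
    refine lt_of_lt_of_le ?_ (measure_mono hsub)
    refine IsOpen.measure_pos _ ?_ ⟨⟨e₁ N, by simp [norm_e₁]⟩, ?_⟩
    · refine isOpen_lt (continuous_iff_continuousAt.mpr fun z ↦ ?_) continuous_const
      refine (InnerProductGeometry.continuousAt_angle (x := (e₁ N, (z : E N))) ?_ ?_).comp
        (f := fun z : sphere (0 : E N) 1 ↦ (e₁ N, (z : E N))) (by fun_prop)
      · exact norm_ne_zero_iff.mp (by simp [norm_e₁])
      · exact norm_ne_zero_iff.mp (by simp)
    · change InnerProductGeometry.angle (e₁ N) (e₁ N) < α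
      rw [InnerProductGeometry.angle_self (norm_ne_zero_iff.mp (by simp [norm_e₁]))]
      exact hαmem.1
  have hne : ∫ z in cap N α, (z : E N) 1 ^ 2 ∂μ ≠ 0 := by
    intro h
    rw [heq, h, mul_zero] at hpos
    exact lt_irrefl _ hpos
  rw [eq_div_iff hne, heq]

/-- Uniqueness of the angle is not needed: the supremum of any nonempty subset of `(0, π/2]` stays
in it. -/
lemma coneAngle_mem (N : ℕ) [N.AtLeastTwo] {p : ℝ} (hp : 2 ≤ p) :
    coneAngle N p ∈ Ioc 0 (Real.pi / 2) := by
  obtain ⟨α, hα, h⟩ := exists_eq_capRatio N hp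
  have hbdd : BddAbove {α | α ∈ Ioc 0 (Real.pi / 2) ∧ p - 1 = capRatio N α} :=
    ⟨Real.pi / 2, fun x hx ↦ hx.1.2⟩
  exact ⟨hα.1.trans_le (le_csSup hbdd ⟨hα, h⟩), csSup_le ⟨α, hα, h⟩ fun x hx ↦ hx.1.2⟩

/-! ### The rotations `dirRotation` -/

/-- The first reflection sends `e₁` to `-e₁`. The second one exchanges `-e₁` and `y`, or fixes `-e₁
= y` in the degenerate case. -/
lemma dirRotation_e₁ {N : ℕ} [N.AtLeastTwo] {y : E N} (hy : ‖y‖ = 1) :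
    dirRotation N y (e₁ N) = y := by
  have h1 : (ℝ ∙ e₁ N)ᗮ.reflection (e₁ N) = -e₁ N :=
    Submodule.reflection_orthogonalComplement_singleton_eq_neg _
  simp only [dirRotation, LinearIsometryEquiv.trans_apply, h1]
  split_ifs with h
  · rw [Submodule.reflection_mem_subspace_eq_self, h]
    rw [Submodule.mem_orthogonal_singleton_iff_inner_left, inner_neg_left, inner_e₂]
    simp [e₁, zero_ne_one_fin.symm]
  · have := Submodule.reflection_sub (F := E N) (v := -e₁ N) (w := y)
      (by rw [norm_neg, norm_e₁, hy])
    have hspan : (ℝ ∙ (-e₁ N - y)) = ℝ ∙ (e₁ N + y) := by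
      rw [← neg_add', ← Set.neg_singleton, Submodule.span_neg]
    simpa only [hspan] using this

lemma measurable_dirRotation (N : ℕ) [N.AtLeastTwo] :
    Measurable fun q : E N × E N ↦ dirRotation N q.1 q.2 := by
  classical
  have heq : (fun q : E N × E N ↦ dirRotation N q.1 q.2) = fun q : E N × E N ↦
      (fun u : E N × E N ↦ -(2 • (⟪u.1, u.2⟫ / ‖u.1‖ ^ 2) • u.1 - u.2))
        (if q.1 = -e₁ N then e₂ N else e₁ N + q.1, (ℝ ∙ e₁ N)ᗮ.reflection q.2) := by
    ext1 q
    simp only [dirRotation, LinearIsometryEquiv.trans_apply]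
    rw [Submodule.reflection_orthogonal_apply (ℝ ∙ _), Submodule.reflection_singleton_apply]
    simp only [RCLike.ofReal_real_eq_id, id]
  rw [heq]
  refine Measurable.comp (g := fun u : E N × E N ↦
    -(2 • (⟪u.1, u.2⟫ / ‖u.1‖ ^ 2) • u.1 - u.2)) (by fun_prop) (Measurable.prodMk ?_ ?_)
  · refine Measurable.ite ?_ measurable_const (by fun_prop)
    exact measurable_fst (measurableSet_singleton _)
  · exact (LinearIsometryEquiv.continuous _).measurable.comp measurable_snd

/-! ### The law of one jump -/

lemma measurableSet_truncCone (N : ℕ) [N.AtLeastTwo] (p : ℝ) :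
    MeasurableSet (truncCone N p 1 (e₁ N)) :=
  (measurable_angle_e₁ N measurableSet_Iio).inter (measurable_norm measurableSet_Ioi)

lemma fracConst_pos {N : ℕ} {s : ℝ} (hs : 0 < s) (hs' : s < 1) : 0 < fracConst N s := by
  unfold fracConst
  have := Real.Gamma_pos_of_pos (s := (N : ℝ) / 2 + s) (by positivity)
  have := Real.Gamma_pos_of_pos (s := 1 - s) (by linarith)
  positivity

/-- The quadratic-linear bound for the error of first order expansions: `r²` for small `r`,
and `r` for large `r`. -/
def sqMin (r : ℝ) : ℝ := min (r ^ 2) r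

lemma sqMin_nonneg {r : ℝ} (hr : 0 ≤ r) : 0 ≤ sqMin r := le_min (sq_nonneg r) hr

lemma continuous_sqMin : Continuous sqMin := by unfold sqMin; fun_prop

lemma sqMin_of_one_le {r : ℝ} (hr : 1 ≤ r) : sqMin r = r := min_eq_right (by nlinarith)

lemma sqMin_of_le_one {r : ℝ} (h0 : 0 ≤ r) (hr : r ≤ 1) : sqMin r = r ^ 2 :=
  min_eq_left (by nlinarith)

lemma measurable_fracDensity (N : ℕ) (s : ℝ) :
    Measurable fun z : E N ↦ ENNReal.ofReal (fracConst N s / ‖z‖ ^ ((N : ℝ) + 2 * s)) := by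
  fun_prop

/-- In polar coordinates the integrand is `r^(1 - 2s)` near zero, integrable as `s < 1`, and
`r^(-2s)` at infinity, integrable as `s > 1/2`. -/
lemma integrable_sqMin_div_rpow (N : ℕ) [N.AtLeastTwo] {s : ℝ} (hs : 1 / 2 < s) (hs' : s < 1) :
    Integrable (fun z : E N ↦ sqMin ‖z‖ / ‖z‖ ^ ((N : ℝ) + 2 * s)) := by
  have hN : 1 ≤ N := by have := Nat.AtLeastTwo.prop (n := N); lia
  rw [integrable_fun_norm_addHaar volume (f := fun r ↦ sqMin r / r ^ ((N : ℝ) + 2 * s)),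
    ← Ioc_union_Ioi_eq_Ioi zero_le_one, integrableOn_union]
  have hpow : ∀ y : ℝ, 0 < y → y ^ (Module.finrank ℝ (E N) - 1) = y ^ ((N : ℝ) - 1) := by
    intro y hy
    rw [finrank_euclideanSpace_fin, ← Real.rpow_natCast, Nat.cast_sub hN, Nat.cast_one]
  constructor
  · have h : IntegrableOn (fun y : ℝ ↦ y ^ (1 - 2 * s)) (Ioc 0 1) :=
      (intervalIntegral.intervalIntegrable_rpow' (by linarith)).1
    refine h.congr_fun (fun y hy ↦ ?_) measurableSet_Ioc
    simp only [smul_eq_mul]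
    rw [hpow y hy.1, sqMin_of_le_one hy.1.le hy.2, ← Real.rpow_natCast y 2, ← Real.rpow_sub hy.1,
      ← Real.rpow_add hy.1]
    congr 1; push_cast; ring
  · have h : IntegrableOn (fun y : ℝ ↦ y ^ (-(2 * s))) (Ioi 1) :=
      integrableOn_Ioi_rpow_of_lt (by linarith) one_pos
    refine h.congr_fun (fun y hy ↦ ?_) measurableSet_Ioi
    have hy0 : 0 < y := one_pos.trans hy
    simp only [smul_eq_mul]
    rw [hpow y hy0, sqMin_of_one_le (le_of_lt hy)]
    nth_rw 3 [← Real.rpow_one y]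
    rw [← Real.rpow_sub hy0, ← Real.rpow_add hy0]
    congr 1; ring

/-- The scaling property of `fracMeasure`, tested on `sqMin`. -/
lemma lintegral_sqMin_fracMeasure {N : ℕ} [N.AtLeastTwo] {s t : ℝ} (ht : 0 < t) :
    ∫⁻ z, ENNReal.ofReal (sqMin (t * ‖z‖)) ∂fracMeasure N s =
      ENNReal.ofReal (t ^ (2 * s)) * ∫⁻ z, ENNReal.ofReal (sqMin ‖z‖) ∂fracMeasure N s := by
  have hφ : Measurable fun z : E N ↦ ENNReal.ofReal (sqMin ‖z‖) := by
    have := continuous_sqMin.measurable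
    fun_prop
  have hφt : Measurable fun z : E N ↦ ENNReal.ofReal (sqMin (t * ‖z‖)) := by
    have := continuous_sqMin.measurable
    fun_prop
  unfold fracMeasure
  rw [lintegral_withDensity_eq_lintegral_mul _ (measurable_fracDensity N s) hφt,
    lintegral_withDensity_eq_lintegral_mul _ (measurable_fracDensity N s) hφ,
    ← lintegral_const_mul _ ((measurable_fracDensity N s).mul hφ)]
  set F : E N → ℝ≥0∞ := ((fun z : E N ↦ ENNReal.ofReal (fracConst N s / ‖z‖ ^ ((N : ℝ) + 2 * s))) *
    fun z ↦ ENNReal.ofReal (sqMin ‖z‖)) with hF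
  have hFm : Measurable F := (measurable_fracDensity N s).mul hφ
  have hscale : ∫⁻ z, F (t • z) = ENNReal.ofReal (t ^ (-(N : ℝ))) * ∫⁻ z, F z := by
    have h1 : ∫⁻ z, F (t • z) = ∫⁻ z, F z ∂(Measure.map (t • ·) (volume : Measure (E N))) :=
      (lintegral_map hFm (measurable_const_smul t)).symm
    rw [h1, Measure.map_addHaar_smul _ ht.ne', lintegral_smul_measure, smul_eq_mul]
    congr 2
    rw [finrank_euclideanSpace_fin, abs_of_pos (by positivity), Real.rpow_neg ht.le,
      Real.rpow_natCast]
  have hpoint : ∀ z : E N, ENNReal.ofReal (fracConst N s / ‖z‖ ^ ((N : ℝ) + 2 * s)) *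
      ENNReal.ofReal (sqMin (t * ‖z‖)) = ENNReal.ofReal (t ^ ((N : ℝ) + 2 * s)) * F (t • z) := by
    intro z
    simp only [hF, Pi.mul_apply, norm_smul, Real.norm_of_nonneg ht.le]
    rw [← mul_assoc, ← ENNReal.ofReal_mul (p := t ^ ((N : ℝ) + 2 * s)) (by positivity),
      Real.mul_rpow ht.le (norm_nonneg z)]
    congr 2
    have : t ^ ((N : ℝ) + 2 * s) ≠ 0 := (Real.rpow_pos_of_pos ht _).ne'
    -- If the power of the norm vanishes, both quotients take the default value `0`.
    rcases eq_or_ne (‖z‖ ^ ((N : ℝ) + 2 * s)) 0 with h | h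
    · simp [h]
    · field_simp
  simp only [Pi.mul_apply, hpoint]
  rw [lintegral_const_mul (f := fun z ↦ F (t • z)) _ (hFm.comp (measurable_const_smul t)), hscale, ← mul_assoc,
    ← ENNReal.ofReal_mul (by positivity), ← Real.rpow_add ht, lintegral_const_mul _ hFm]
  congr 3; ring

lemma lintegral_sqMin_fracMeasure_lt_top {N : ℕ} [N.AtLeastTwo] {s : ℝ} (hs : 1 / 2 < s)
    (hs' : s < 1) : ∫⁻ z, ENNReal.ofReal (sqMin ‖z‖) ∂fracMeasure N s < ∞ := by
  have hφ : Measurable fun z : E N ↦ ENNReal.ofReal (sqMin ‖z‖) := by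
    have := continuous_sqMin.measurable
    fun_prop
  unfold fracMeasure
  rw [lintegral_withDensity_eq_lintegral_mul _ (measurable_fracDensity N s) hφ]
  have hc := fracConst_pos (N := N) (by linarith) hs'
  have h := ((integrable_sqMin_div_rpow N hs hs').const_mul (fracConst N s)).2
  rw [hasFiniteIntegral_iff_ofReal (.of_forall fun z ↦ by
    have := sqMin_nonneg (norm_nonneg z); simp only [Pi.zero_apply]; positivity)] at h
  refine lt_of_eq_of_lt (lintegral_congr fun z ↦ ?_) h
  rw [Pi.mul_apply, ← ENNReal.ofReal_mul (by positivity)]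
  congr 1; ring

lemma one_lt_norm_of_mem {N : ℕ} [N.AtLeastTwo] {p : ℝ} (z : truncCone N p 1 (e₁ N)) :
    1 < ‖(z : E N)‖ := z.2.2

lemma fracMeasure_truncCone_lt_top {N : ℕ} [N.AtLeastTwo] {p s : ℝ} (hs : 1 / 2 < s)
    (hs' : s < 1) : fracMeasure N s (truncCone N p 1 (e₁ N)) < ∞ := by
  refine lt_of_le_of_lt ?_ (lintegral_sqMin_fracMeasure_lt_top (N := N) hs hs')
  rw [← lintegral_indicator_one (measurableSet_truncCone N p)]
  refine lintegral_mono fun z ↦ ?_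
  by_cases hz : z ∈ truncCone N p 1 (e₁ N)
  · rw [indicator_of_mem hz, sqMin_of_one_le (le_of_lt hz.2)]
    exact ENNReal.one_le_ofReal.mpr (le_of_lt hz.2)
  · rw [indicator_of_notMem hz]; exact zero_le

lemma ball_subset_truncCone {N : ℕ} [N.AtLeastTwo] {p κ : ℝ} (hκ4 : κ ≤ 1 / 4)
    (hκ : ∀ (e q : E N) (r : ℝ), ‖e‖ = 1 → 0 < r → ‖q‖ ≤ κ * r →
      InnerProductGeometry.angle e (r • e + q) < coneAngle N p) {R : ℝ} (hR : 2 ≤ R) :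
    ball (R • e₁ N) (κ * R) ⊆ truncCone N p 1 (e₁ N) := by
  intro z hz
  rw [mem_ball, dist_eq_norm] at hz
  have hadd : R • e₁ N + (z - R • e₁ N) = z := by abel
  refine ⟨?_, ?_⟩
  · have := hκ (e₁ N) (z - R • e₁ N) R (norm_e₁ N) (by linarith) hz.le
    rwa [hadd] at this
  · have h1 := norm_sub_norm_le (R • e₁ N) (R • e₁ N - z)
    rw [sub_sub_cancel, norm_sub_rev (R • e₁ N) z, norm_smul, norm_e₁,
      Real.norm_of_nonneg (by linarith)] at h1
    nlinarith

/-- The ball has volume of order `R ^ N`, and on it the density is at least of order `R^(-N - 2s)`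
because `‖z‖ ≤ 2R`. -/
lemma fracMeasure_ball_ge {N : ℕ} [N.AtLeastTwo] {s κ : ℝ} (hs : 0 < s) (hs' : s < 1)
    (hκ0 : 0 < κ) (hκ4 : κ ≤ 1 / 4) :
    ∃ c : ℝ, 0 < c ∧ ∀ R : ℝ, 0 < R →
      ENNReal.ofReal (c * R ^ (-(2 * s))) ≤ fracMeasure N s (ball (R • e₁ N) (κ * R)) := by
  have hC := fracConst_pos (N := N) hs hs'
  have hv : 0 < volume.real (ball (0 : E N) 1) :=
    ENNReal.toReal_pos (measure_ball_pos _ _ one_pos).ne' measure_ball_lt_top.ne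
  refine ⟨fracConst N s / 2 ^ ((N : ℝ) + 2 * s) * (κ ^ N * volume.real (ball (0 : E N) 1)),
    by positivity, fun R hR ↦ ?_⟩
  rw [fracMeasure, withDensity_apply _ measurableSet_ball]
  have hlow : ∀ z ∈ ball (R • e₁ N) (κ * R), ENNReal.ofReal
      (fracConst N s / (2 * R) ^ ((N : ℝ) + 2 * s)) ≤
      ENNReal.ofReal (fracConst N s / ‖z‖ ^ ((N : ℝ) + 2 * s)) := by
    intro z hz
    rw [mem_ball, dist_eq_norm] at hz
    have hRe : ‖R • e₁ N‖ = R := by rw [norm_smul, norm_e₁, Real.norm_of_nonneg hR.le, mul_one]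
    have h1 := norm_sub_norm_le z (R • e₁ N)
    have h2 := norm_sub_norm_le (R • e₁ N) z
    rw [norm_sub_rev] at h2
    rw [hRe] at h1 h2
    have hz0 : 0 < ‖z‖ := by nlinarith
    have hz2 : ‖z‖ ≤ 2 * R := by nlinarith
    gcongr
  refine le_trans (le_of_eq ?_) (setLIntegral_mono (measurable_fracDensity N s) hlow)
  rw [setLIntegral_const, Measure.addHaar_ball _ _ (by positivity), finrank_euclideanSpace_fin,
    ← ofReal_measureReal (measure_ball_lt_top.ne), ← ENNReal.ofReal_mul (by positivity),
    ← ENNReal.ofReal_mul (by positivity)]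
  congr 1
  rw [Real.mul_rpow (by norm_num) hR.le, Real.rpow_add hR, Real.rpow_neg hR.le, mul_pow,
    Real.rpow_natCast]
  field_simp

lemma fracMeasure_truncCone_pos {N : ℕ} [N.AtLeastTwo] {p s : ℝ} (hp : 2 ≤ p) (hs : 0 < s)
    (hs' : s < 1) : 0 < fracMeasure N s (truncCone N p 1 (e₁ N)) := by
  obtain ⟨κ, hκ0, hκ4, hκ⟩ := exists_forall_angle_add_lt (F := E N) (coneAngle_mem N hp)
  obtain ⟨c, hc, h⟩ := fracMeasure_ball_ge (N := N) hs hs' hκ0 hκ4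
  refine lt_of_lt_of_le ?_ ((h 2 two_pos).trans
    (measure_mono (ball_subset_truncCone hκ4 hκ le_rfl)))
  rw [ENNReal.ofReal_pos]; positivity

lemma isProbabilityMeasure_jumpLaw {N : ℕ} [N.AtLeastTwo] {p s : ℝ} (hp : 2 ≤ p) (hs : 1 / 2 < s)
    (hs' : s < 1) : IsProbabilityMeasure (jumpLaw N p s) := by
  refine ⟨?_⟩
  rw [jumpLaw, Measure.smul_apply, comap_subtype_coe_apply (measurableSet_truncCone N p),
    image_univ, Subtype.range_coe, smul_eq_mul]
  exact ENNReal.inv_mul_cancel (fracMeasure_truncCone_pos hp (by linarith) hs').ne'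
    (fracMeasure_truncCone_lt_top hs hs').ne

lemma map_jumpLaw (N : ℕ) [N.AtLeastTwo] (p s : ℝ) :
    (jumpLaw N p s).map Subtype.val = (fracMeasure N s (truncCone N p 1 (e₁ N)))⁻¹ •
      (fracMeasure N s).restrict (truncCone N p 1 (e₁ N)) := by
  rw [jumpLaw, Measure.map_smul, map_comap_subtype_coe (measurableSet_truncCone N p)]

/-- The truncated moments of the jumps. -/
lemma exists_integral_sqMin_le {N : ℕ} [N.AtLeastTwo] {p s : ℝ} (hp : 2 ≤ p) (hs : 1 / 2 < s)
    (hs' : s < 1) : ∃ K : ℝ, 0 < K ∧ ∀ t : ℝ, 0 < t →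
      Integrable (fun z : truncCone N p 1 (e₁ N) ↦ sqMin (t * ‖(z : E N)‖)) (jumpLaw N p s) ∧
      ∫ z : truncCone N p 1 (e₁ N), sqMin (t * ‖(z : E N)‖) ∂jumpLaw N p s ≤ K * t ^ (2 * s) := by
  have hpos := fracMeasure_truncCone_pos (N := N) hp (by linarith) hs'
  set A := (fracMeasure N s (truncCone N p 1 (e₁ N)))⁻¹ *
    ∫⁻ z, ENNReal.ofReal (sqMin ‖z‖) ∂fracMeasure N s with hA
  have hAtop : A < ∞ := ENNReal.mul_lt_top (ENNReal.inv_lt_top.mpr hpos)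
    (lintegral_sqMin_fracMeasure_lt_top hs hs')
  refine ⟨A.toReal + 1, by positivity, fun t ht ↦ ?_⟩
  have hm : Measurable fun z : E N ↦ ENNReal.ofReal (sqMin (t * ‖z‖)) := by
    have := continuous_sqMin.measurable
    fun_prop
  have hnn : ∀ z : truncCone N p 1 (e₁ N), 0 ≤ sqMin (t * ‖(z : E N)‖) :=
    fun z ↦ sqMin_nonneg (by positivity)
  have hmeas : Measurable fun z : truncCone N p 1 (e₁ N) ↦ sqMin (t * ‖(z : E N)‖) := by
    have := continuous_sqMin.measurable
    fun_prop
  have hle : ∫⁻ z : truncCone N p 1 (e₁ N), ENNReal.ofReal (sqMin (t * ‖(z : E N)‖))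
      ∂jumpLaw N p s ≤ ENNReal.ofReal (t ^ (2 * s)) * A := by
    rw [← lintegral_map (f := fun z : E N ↦ ENNReal.ofReal (sqMin (t * ‖z‖))) hm
      measurable_subtype_coe, map_jumpLaw, lintegral_smul_measure, hA, mul_left_comm, smul_eq_mul]
    gcongr
    rw [← lintegral_sqMin_fracMeasure ht]
    exact setLIntegral_le_lintegral _ _
  have hfin : ENNReal.ofReal (t ^ (2 * s)) * A < ∞ :=
    ENNReal.mul_lt_top ENNReal.ofReal_lt_top hAtop
  refine ⟨⟨hmeas.aestronglyMeasurable, ?_⟩, ?_⟩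
  · rw [hasFiniteIntegral_iff_ofReal (.of_forall hnn)]
    exact hle.trans_lt hfin
  · rw [integral_eq_lintegral_of_nonneg_ae (.of_forall hnn) hmeas.aestronglyMeasurable]
    refine (ENNReal.toReal_mono hfin.ne hle).trans ?_
    rw [ENNReal.toReal_mul, ENNReal.toReal_ofReal (by positivity), mul_comm]
    gcongr
    linarith

/-- The source of Player I's gain: a jump into a prescribed ball of size proportional to its
distance `R`. The exponent `-2s` matches the error bound of `exists_integral_sqMin_le`; `R ≥ 2`
keeps the ball in `‖z‖ > 1`. -/
lemma exists_jumpLaw_ball_ge {N : ℕ} [N.AtLeastTwo] {p s : ℝ} (hp : 2 ≤ p) (hs : 1 / 2 < s)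
    (hs' : s < 1) {κ' : ℝ} (hκ' : 0 < κ') : ∃ κ : ℝ, 0 < κ ∧ κ ≤ κ' ∧ κ ≤ 1 / 4 ∧
      ∃ c : ℝ, 0 < c ∧ ∀ R : ℝ, 2 ≤ R → c * R ^ (-(2 * s)) ≤
        (jumpLaw N p s).real {z | (z : E N) ∈ ball (R • e₁ N) (κ * R)} := by
  have := isProbabilityMeasure_jumpLaw (N := N) hp hs hs'
  obtain ⟨κ₀, hκ0, hκ4, hκ⟩ := exists_forall_angle_add_lt (F := E N) (coneAngle_mem N hp)
  set κ := min κ₀ κ'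
  have hκpos : 0 < κ := lt_min hκ0 hκ'
  have hκ4' : κ ≤ 1 / 4 := (min_le_left _ _).trans hκ4
  obtain ⟨c, hc, h⟩ := fracMeasure_ball_ge (N := N) (by linarith) hs' hκpos hκ4'
  have hTpos := fracMeasure_truncCone_pos (N := N) hp (by linarith) hs'
  have hTtop := fracMeasure_truncCone_lt_top (N := N) (p := p) hs hs'
  set A := fracMeasure N s (truncCone N p 1 (e₁ N)) with hA
  have hAr : 0 < A.toReal := ENNReal.toReal_pos hTpos.ne' hTtop.ne
  refine ⟨κ, hκpos, min_le_right _ _, hκ4', A.toReal⁻¹ * c, by positivity, fun R hR ↦ ?_⟩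
  have hpre : {z : truncCone N p 1 (e₁ N) | (z : E N) ∈ ball (R • e₁ N) (κ * R)} =
      Subtype.val ⁻¹' ball (R • e₁ N) (κ * R) := rfl
  rw [hpre, ← map_measureReal_apply measurable_subtype_coe measurableSet_ball, map_jumpLaw,
    measureReal_def, Measure.smul_apply, Measure.restrict_apply measurableSet_ball,
    inter_eq_left.mpr (ball_subset_truncCone hκ4' (fun e q r he hr hq ↦ hκ e q r he hr
      (hq.trans (by gcongr; exact min_le_left _ _))) hR), smul_eq_mul, ENNReal.toReal_mul,
    ENNReal.toReal_inv, ← hA, mul_assoc]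
  gcongr
  rw [← ENNReal.ofReal_le_iff_le_toReal]
  · exact h R (by linarith)
  · refine ne_top_of_le_ne_top hTtop.ne (measure_mono (ball_subset_truncCone hκ4'
      (fun e q r he hr hq ↦ hκ e q r he hr (hq.trans (by gcongr; exact min_le_left _ _))) hR))

lemma jumpLaw_norm_le_lt_one {N : ℕ} [N.AtLeastTwo] {p s : ℝ} (hp : 2 ≤ p) (hs : 1 / 2 < s)
    (hs' : s < 1) (M : ℝ) : jumpLaw N p s {z | ‖(z : E N)‖ ≤ M} < 1 := by
  have := isProbabilityMeasure_jumpLaw (N := N) hp hs hs'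
  obtain ⟨κ, hκ0, -, hκ4, c, hc, h⟩ := exists_jumpLaw_ball_ge (N := N) hp hs hs' one_pos
  set R := max 2 (2 * M)
  have hR2 : 2 ≤ R := le_max_left _ _
  have hRM : 2 * M ≤ R := le_max_right _ _
  have hms : MeasurableSet {z : truncCone N p 1 (e₁ N) | ‖(z : E N)‖ ≤ M} :=
    measurableSet_le (by fun_prop) measurable_const
  have hpos : 0 < jumpLaw N p s {z | (z : E N) ∈ ball (R • e₁ N) (κ * R)} := by
    have h0 : 0 < c * R ^ (-(2 * s)) := by positivity
    exact (ENNReal.toReal_pos_iff.mp (h0.trans_le (h R hR2))).1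
  have hsub : {z : truncCone N p 1 (e₁ N) | (z : E N) ∈ ball (R • e₁ N) (κ * R)} ⊆
      {z | ‖(z : E N)‖ ≤ M}ᶜ := by
    intro z hz hzM
    have hz' : ‖(z : E N) - R • e₁ N‖ < κ * R := by
      rw [← dist_eq_norm]; exact hz
    have hzM' : ‖(z : E N)‖ ≤ M := hzM
    have h1 := norm_sub_norm_le (R • e₁ N) (z : E N)
    rw [norm_sub_rev, norm_smul, norm_e₁, Real.norm_of_nonneg (by linarith)] at h1
    nlinarith
  have hc1 := prob_compl_eq_one_sub (μ := jumpLaw N p s) hms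
  by_contra hcon
  have h1 : jumpLaw N p s {z | ‖(z : E N)‖ ≤ M} = 1 := le_antisymm prob_le_one (not_lt.mp hcon)
  rw [h1, tsub_self] at hc1
  exact (hpos.trans_le (measure_mono hsub)).ne' hc1

lemma integrable_jumpLaw {N : ℕ} [N.AtLeastTwo] {p s : ℝ} (hp : 2 ≤ p) (hs : 1 / 2 < s)
    (hs' : s < 1) :
    Integrable (fun z : truncCone N p 1 (e₁ N) ↦ (z : E N)) (jumpLaw N p s) := by
  obtain ⟨K, -, hK⟩ := exists_integral_sqMin_le (N := N) hp hs hs'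
  refine (hK 1 one_pos).1.mono' measurable_subtype_coe.aestronglyMeasurable
    (.of_forall fun z ↦ ?_)
  rw [one_mul, sqMin_of_one_le (one_lt_norm_of_mem z).le]

lemma measurePreserving_fracMeasure (N : ℕ) (s : ℝ) (L : E N ≃ₗᵢ[ℝ] E N) :
    MeasurePreserving L (fracMeasure N s) (fracMeasure N s) := by
  refine ⟨L.continuous.measurable, Measure.ext fun t ht ↦ ?_⟩
  rw [Measure.map_apply L.continuous.measurable ht, fracMeasure, withDensity_apply _ ht,
    withDensity_apply _ (L.continuous.measurable ht),
    ← L.measurePreserving.setLIntegral_comp_preimage ht (measurable_fracDensity N s)]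
  simp

lemma map_integral_of_measurePreserving {F : Type*} [NormedAddCommGroup F] [NormedSpace ℝ F]
    [MeasurableSpace F] [BorelSpace F] (L : F ≃ₗᵢ[ℝ] F) {ν : Measure F}
    (h : MeasurePreserving L ν ν) : L (∫ z, z ∂ν) = ∫ z, z ∂ν := by
  have h1 := h.integral_comp L.toHomeomorph.measurableEmbedding (fun z ↦ z)
  have h2 := L.toContinuousLinearEquiv.integral_comp_comm (μ := ν) (fun z ↦ z)
  exact h2.symm.trans h1

/-- The mean jump points along the axis of the cone. -/
lemma exists_integral_jumpLaw {N : ℕ} [N.AtLeastTwo] {p s : ℝ} (hp : 2 ≤ p) (hs : 1 / 2 < s)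
    (hs' : s < 1) : ∃ m : ℝ, 0 ≤ m ∧
      ∫ z : truncCone N p 1 (e₁ N), (z : E N) ∂jumpLaw N p s = m • e₁ N := by
  set w := ∫ z : truncCone N p 1 (e₁ N), (z : E N) ∂jumpLaw N p s with hw
  set T := truncCone N p 1 (e₁ N)
  have hInt : Integrable (fun z : T ↦ (z : E N)) (jumpLaw N p s) := integrable_jumpLaw hp hs hs'
  have hwmap : w = ∫ z, z ∂(jumpLaw N p s).map Subtype.val := by
    rw [integral_map measurable_subtype_coe.aemeasurable (by fun_prop)]
  -- Reflection in the axis preserves both the cone and the jump law, so it fixes the mean, which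
  -- must then lie on the axis.
  set ρ := (ℝ ∙ e₁ N).reflection with hρ
  have hρe : ρ (e₁ N) = e₁ N :=
    Submodule.reflection_mem_subspace_eq_self (Submodule.mem_span_singleton_self _)
  have hpre : ρ ⁻¹' T = T := by
    ext z
    have : InnerProductGeometry.angle (e₁ N) (ρ z) = InnerProductGeometry.angle (e₁ N) z := by
      conv_lhs => rw [← hρe]
      exact ρ.toLinearIsometry.angle_map _ _
    simp [T, truncCone, this]
  have hmp : MeasurePreserving ρ ((jumpLaw N p s).map Subtype.val)
      ((jumpLaw N p s).map Subtype.val) := by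
    rw [map_jumpLaw]
    have := (measurePreserving_fracMeasure N s ρ).restrict_preimage (measurableSet_truncCone N p)
    rw [hpre] at this
    exact this.smul_measure _
  have hfix : ρ w = w := by
    rw [hwmap]
    exact map_integral_of_measurePreserving ρ hmp
  rw [hρ, Submodule.reflection_eq_self_iff, Submodule.mem_span_singleton] at hfix
  obtain ⟨m, hm⟩ := hfix
  refine ⟨m, ?_, hm.symm⟩
  have hm' : m = ∫ z : T, ⟪e₁ N, (z : E N)⟫ ∂jumpLaw N p s := by
    rw [integral_inner hInt, ← hw, ← hm, inner_smul_right, real_inner_self_eq_norm_sq, norm_e₁]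
    simp
  rw [hm']
  refine integral_nonneg fun z ↦ ?_
  have hang : InnerProductGeometry.angle (e₁ N) (z : E N) ≤ Real.pi / 2 :=
    z.2.1.le.trans (coneAngle_mem N hp).2
  rw [Pi.zero_apply, ← InnerProductGeometry.cos_angle_mul_norm_mul_norm]
  have := Real.cos_nonneg_of_mem_Icc (x := InnerProductGeometry.angle (e₁ N) (z : E N))
    ⟨by linarith [Real.pi_pos, InnerProductGeometry.angle_nonneg (e₁ N) (z : E N)], hang⟩
  positivity

/-! ### An eccentric gauge

The level set `{coneGauge e = G}` is the sphere with radius `2G/3` centred at `(G/3) e`. -/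

section Gauge

variable {F : Type*} [NormedAddCommGroup F] [InnerProductSpace ℝ F]

/-- The gauge whose level sets are spheres centred on the half-line spanned by `e`. -/
def coneGauge (e x : F) : ℝ := √(⟪x, e⟫ ^ 2 + 3 * ‖x‖ ^ 2) - ⟪x, e⟫

/-- The direction from `x` to the centre of the level sphere of `coneGauge e` through `x`. -/
def pullDir (e x : F) : F :=
  (3 / (2 * coneGauge e x)) • ((coneGauge e x / 3) • e - x)

lemma continuous_coneGauge (e : F) : Continuous (coneGauge e) := by
  unfold coneGauge; fun_prop

variable {e : F}

lemma abs_inner_le_of_norm_eq_one (he : ‖e‖ = 1) (x : F) : |⟪x, e⟫| ≤ ‖x‖ := by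
  simpa [he] using abs_real_inner_le_norm x e

lemma norm_le_coneGauge (he : ‖e‖ = 1) (x : F) : ‖x‖ ≤ coneGauge e x := by
  have h := abs_le.mp (abs_inner_le_of_norm_eq_one he x)
  rw [coneGauge, le_sub_iff_add_le]
  apply Real.le_sqrt_of_sq_le
  nlinarith [norm_nonneg x]

lemma coneGauge_le (he : ‖e‖ = 1) (x : F) : coneGauge e x ≤ 3 * ‖x‖ := by
  have h := abs_le.mp (abs_inner_le_of_norm_eq_one he x)
  have : √(⟪x, e⟫ ^ 2 + 3 * ‖x‖ ^ 2) ≤ 2 * ‖x‖ := by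
    rw [Real.sqrt_le_left (by positivity)]
    nlinarith [norm_nonneg x]
  rw [coneGauge]
  linarith

/-- The quadratic equation for `G` equivalent to `‖(G/3) • e - x‖ = 2G/3`, the equation of the level
sphere, when `‖e‖ = 1` and `G ≥ 0`. -/
lemma coneGauge_sq (e x : F) :
    coneGauge e x ^ 2 + 2 * ⟪x, e⟫ * coneGauge e x = 3 * ‖x‖ ^ 2 := by
  have := Real.sq_sqrt (show 0 ≤ ⟪x, e⟫ ^ 2 + 3 * ‖x‖ ^ 2 by positivity)
  rw [coneGauge]
  linear_combination this

lemma norm_smul_sub_eq_coneGauge (he : ‖e‖ = 1) (x : F) :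
    ‖(coneGauge e x / 3) • e - x‖ = 2 / 3 * coneGauge e x := by
  have h0 : 0 ≤ coneGauge e x := (norm_nonneg x).trans (norm_le_coneGauge he x)
  rw [← sq_eq_sq₀ (norm_nonneg _) (by positivity), norm_sub_sq_real, norm_smul, he,
    inner_smul_left, real_inner_comm, Real.norm_of_nonneg (by positivity)]
  simp only [RCLike.conj_to_real, mul_one]
  linear_combination (-1 / 3 : ℝ) * coneGauge_sq e x

lemma norm_pullDir (he : ‖e‖ = 1) {x : F} (hx : 0 < coneGauge e x) : ‖pullDir e x‖ = 1 := by
  rw [pullDir, norm_smul, norm_smul_sub_eq_coneGauge he, Real.norm_of_nonneg (by positivity)]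
  field_simp

lemma add_smul_pullDir {x : F} (hx : 0 < coneGauge e x) :
    x + (2 / 3 * coneGauge e x) • pullDir e x = (coneGauge e x / 3) • e := by
  rw [pullDir, smul_smul, show 2 / 3 * coneGauge e x * (3 / (2 * coneGauge e x)) = 1 by field_simp,
    one_smul]
  abel

/-- The first order expansion of the gauge, with a one-sided error bound. -/
lemma exists_coneGauge_add_le (he : ‖e‖ = 1) {x : F} (hx : 0 < coneGauge e x) :
    ∃ a : ℝ, 0 ≤ a ∧ ∀ w : F, coneGauge e (x + w) ≤
      coneGauge e x * (1 - a * ⟪pullDir e x, w⟫ + 10 * sqMin (‖w‖ / coneGauge e x)) := by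
  set G := coneGauge e x with hG
  set S := √(⟪x, e⟫ ^ 2 + 3 * ‖x‖ ^ 2) with hS
  have hSsq : S ^ 2 = ⟪x, e⟫ ^ 2 + 3 * ‖x‖ ^ 2 := Real.sq_sqrt (by positivity)
  have hGS : G = S - ⟪x, e⟫ := rfl
  have hS0 : 0 ≤ S := Real.sqrt_nonneg _
  have huS : |⟪x, e⟫| ≤ S := Real.abs_le_sqrt (by nlinarith [norm_nonneg x])
  have hGS2 : G ≤ 2 * S := by linarith [(abs_le.mp huS).1]
  have hSpos : 0 < S := by linarith
  -- The gradient of the gauge at `x` is `(3x - G e) / S = -(2G / S) • pullDir e x`.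
  refine ⟨2 / S, by positivity, fun w ↦ ?_⟩
  rcases le_or_gt ‖w‖ G with hw | hw
  · have hwG : ‖w‖ / G ≤ 1 := (div_le_one hx).mpr hw
    rw [sqMin_of_le_one (by positivity) hwG]
    set c := 2 * (⟪x, e⟫ * ⟪w, e⟫ + 3 * ⟪x, w⟫) + (⟪w, e⟫ ^ 2 + 3 * ‖w‖ ^ 2) with hc
    have hexp : ⟪x + w, e⟫ ^ 2 + 3 * ‖x + w‖ ^ 2 = S ^ 2 + c := by
      rw [hSsq, hc, inner_add_left, norm_add_sq_real]; ring
    have hcS : 0 ≤ S ^ 2 + c := by rw [← hexp]; positivity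
    -- Concavity of the square root gives the one-sided bound without a Taylor remainder.
    have hsqrt : √(S ^ 2 + c) ≤ S + c / (2 * S) := by
      apply Real.sqrt_le_iff.mpr
      have h2 : S + c / (2 * S) = (S ^ 2 + (S ^ 2 + c)) / (2 * S) := by field_simp; ring
      constructor
      · rw [h2]; positivity
      · have h3 : (S + c / (2 * S)) ^ 2 = S ^ 2 + c + (c / (2 * S)) ^ 2 := by field_simp; ring
        rw [h3]; linarith [sq_nonneg (c / (2 * S))]
    have hlin : G * (2 / S * ⟪pullDir e x, w⟫) = (G * ⟪w, e⟫ - 3 * ⟪x, w⟫) / S := by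
      rw [pullDir, inner_smul_left, inner_sub_left, inner_smul_left, real_inner_comm w e, ← hG]
      simp only [RCLike.conj_to_real]
      field_simp
    have hwe : ⟪w, e⟫ ^ 2 ≤ ‖w‖ ^ 2 := by
      rw [← sq_abs ⟪w, e⟫]
      exact pow_le_pow_left₀ (abs_nonneg _) (abs_inner_le_of_norm_eq_one he w) 2
    have hquad : (⟪w, e⟫ ^ 2 + 3 * ‖w‖ ^ 2) / (2 * S) ≤ G * (10 * (‖w‖ / G) ^ 2) := by
      have h1 : G * (10 * (‖w‖ / G) ^ 2) = 10 * ‖w‖ ^ 2 / G := by field_simp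
      rw [h1, div_le_div_iff₀ (by positivity) hx]
      nlinarith [sq_nonneg ‖w‖, mul_le_mul_of_nonneg_left hGS2 (sq_nonneg ‖w‖),
        mul_le_mul_of_nonneg_right hwe hx.le]
    have hsplit : S + c / (2 * S) - ⟪x + w, e⟫ = G - (G * ⟪w, e⟫ - 3 * ⟪x, w⟫) / S +
        (⟪w, e⟫ ^ 2 + 3 * ‖w‖ ^ 2) / (2 * S) := by
      rw [hGS, hc, inner_add_left]; field_simp; ring
    calc coneGauge e (x + w) = √(S ^ 2 + c) - ⟪x + w, e⟫ := by rw [coneGauge, hexp]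
      _ ≤ S + c / (2 * S) - ⟪x + w, e⟫ := by linarith
      _ ≤ _ := by rw [hsplit]; linarith
  · rw [sqMin_of_one_le ((one_le_div hx).mpr hw.le)]
    -- For long jumps the bound is crude: `6‖w‖` for the gauge and `4‖w‖` for the linear term,
    -- whence the constant `10`.
    have h1 : coneGauge e (x + w) ≤ 6 * ‖w‖ := by
      have := norm_add_le x w
      linarith [coneGauge_le he (x + w), norm_le_coneGauge he x]
    have h2 : ⟪pullDir e x, w⟫ ≤ ‖w‖ := by
      simpa [norm_pullDir he hx] using real_inner_le_norm (pullDir e x) w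
    have h3 : G * (2 / S * ⟪pullDir e x, w⟫) ≤ 4 * ‖w‖ := by
      rw [← mul_assoc]
      have h4 : G * (2 / S) ≤ 4 := by
        rw [mul_div_assoc', div_le_iff₀ hSpos]; linarith
      calc G * (2 / S) * ⟪pullDir e x, w⟫ ≤ G * (2 / S) * ‖w‖ := by gcongr
        _ ≤ 4 * ‖w‖ := by gcongr
    have h5 : G * (10 * (‖w‖ / G)) = 10 * ‖w‖ := by field_simp
    linarith

/-- One step of the barrier `(coneGauge / M) ^ γ` killed near the centre of the level sphere. -/
lemma exists_barrier_add_le (he : ‖e‖ = 1) {x : F} (hx : 0 < coneGauge e x) {γ M ρ : ℝ}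
    (hγ0 : 0 < γ) (hγ1 : γ ≤ 1) (hM : 0 < M) (hρ : ρ ≤ 1 / 6) {U : F → ℝ}
    (hU : ∀ z, U z ≤ (coneGauge e z / M) ^ γ)
    (hkill : ∀ z ∈ ball ((coneGauge e x / 3) • e) (ρ * coneGauge e x), U z ≤ 0) :
    ∃ a : ℝ, 0 ≤ a ∧ ∀ w : F, U (x + w) ≤ (coneGauge e x / M) ^ γ *
      (1 + γ * (-(a * ⟪pullDir e x, w⟫) + 10 * sqMin (‖w‖ / coneGauge e x)) -
        {w | x + w ∈ ball ((coneGauge e x / 3) • e) (ρ * coneGauge e x)}.indicator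
          (fun _ ↦ 1 / 6) w) := by
  obtain ⟨a, ha, h⟩ := exists_coneGauge_add_le he hx
  refine ⟨a, ha, fun w ↦ ?_⟩
  set G := coneGauge e x with hG
  have hGw : 0 ≤ coneGauge e (x + w) := (norm_nonneg _).trans (norm_le_coneGauge he _)
  set r := coneGauge e (x + w) / G with hr
  have hr0 : 0 ≤ r := by positivity
  have hrle : r - 1 ≤ -(a * ⟪pullDir e x, w⟫) + 10 * sqMin (‖w‖ / G) := by
    have : r ≤ 1 - a * ⟪pullDir e x, w⟫ + 10 * sqMin (‖w‖ / G) := by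
      rw [hr, div_le_iff₀ hx, mul_comm]; exact h w
    linarith
  -- Bernoulli's inequality for exponents in `(0, 1]`: the error acquires the factor `γ`.
  have hbern : r ^ γ ≤ 1 + γ * (-(a * ⟪pullDir e x, w⟫) + 10 * sqMin (‖w‖ / G)) := by
    have h1 := rpow_one_add_le_one_add_mul_self (s := r - 1) (by linarith) hγ0.le hγ1
    rw [add_sub_cancel] at h1
    exact h1.trans (by gcongr)
  have hprod : (coneGauge e (x + w) / M) ^ γ = (G / M) ^ γ * r ^ γ := by
    rw [← Real.mul_rpow (by positivity) hr0, hr]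
    congr 1; field_simp
  by_cases hw : w ∈ {w | x + w ∈ ball ((G / 3) • e) (ρ * G)}
  · rw [indicator_of_mem hw]
    -- In the killing ball the gauge is still at least `G / 6`, so the Bernoulli bound is at least
    -- `r ^ γ ≥ 1/6`; subtracting `1/6` leaves it nonnegative.
    refine (hkill _ hw).trans (mul_nonneg (by positivity) ?_)
    have hball : ‖x + w - (G / 3) • e‖ < ρ * G := by
      rw [← dist_eq_norm]; exact hw
    have h1 : G / 3 - ρ * G ≤ ‖x + w‖ := by
      have := norm_sub_norm_le ((G / 3) • e) (x + w)
      rw [norm_sub_rev, norm_smul, he, Real.norm_of_nonneg (by positivity), mul_one] at this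
      linarith
    have h2 : 1 / 6 ≤ r := by
      rw [hr, le_div_iff₀ hx]
      nlinarith [norm_le_coneGauge he (x + w)]
    have h3 : (1 / 6 : ℝ) ≤ (1 / 6 : ℝ) ^ γ := by
      simpa using Real.rpow_le_rpow_of_exponent_ge (by norm_num : (0 : ℝ) < 1 / 6)
        (by norm_num) hγ1
    have h4 : (1 / 6 : ℝ) ^ γ ≤ r ^ γ := Real.rpow_le_rpow (by norm_num) h2 hγ0.le
    linarith
  · rw [indicator_of_notMem hw, sub_zero]
    refine (hU _).trans ?_
    rw [hprod]
    gcongr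

end Gauge

/-- The supermartingale inequality for the barrier, when Player I pulls along `pullDir`. -/
lemma integral_barrier_le {N : ℕ} [N.AtLeastTwo] {p s : ℝ} (hp : 2 ≤ p) (hs : 1 / 2 < s)
    (hs' : s < 1) {κ c K : ℝ} (hκ4 : κ ≤ 1 / 4)
    (hc : ∀ R : ℝ, 2 ≤ R → c * R ^ (-(2 * s)) ≤
        (jumpLaw N p s).real {z | (z : E N) ∈ ball (R • e₁ N) (κ * R)})
    (hc0 : 0 < c)
    (hK : ∀ t : ℝ, 0 < t →
      Integrable (fun z : truncCone N p 1 (e₁ N) ↦ sqMin (t * ‖(z : E N)‖)) (jumpLaw N p s) ∧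
      ∫ z : truncCone N p 1 (e₁ N), sqMin (t * ‖(z : E N)‖) ∂jumpLaw N p s ≤ K * t ^ (2 * s))
    {γ M ε : ℝ} (hγ0 : 0 < γ) (hγ1 : γ ≤ 1) (hγ : 120 * γ * K ≤ c) (hM : 0 < M)
    {e x : E N} (he : ‖e‖ = 1) (hx : 0 < coneGauge e x) (hε0 : 0 < ε)
    (hε : 3 * ε ≤ coneGauge e x) {U : E N → ℝ} (hU0 : ∀ z, 0 ≤ U z)
    (hU : ∀ z, U z ≤ (coneGauge e z / M) ^ γ)
    (hkill : ∀ z ∈ ball ((coneGauge e x / 3) • e) (2 / 3 * κ * coneGauge e x), U z ≤ 0)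
    {y' : E N} (hy' : ‖y'‖ = 1) :
    (∫ z : truncCone N p 1 (e₁ N),
        U (x + ε • dirRotation N (pullDir e x) (z : E N)) ∂jumpLaw N p s) +
      ∫ z : truncCone N p 1 (e₁ N), U (x + ε • dirRotation N y' (z : E N)) ∂jumpLaw N p s ≤
        2 * (coneGauge e x / M) ^ γ := by
  have := isProbabilityMeasure_jumpLaw (N := N) hp hs hs'
  set P := jumpLaw N p s
  set G := coneGauge e x with hG
  set y := pullDir e x with hy
  have hynorm : ‖y‖ = 1 := norm_pullDir he hx
  obtain ⟨a, ha, hstep⟩ := exists_barrier_add_le he hx hγ0 hγ1 hM (by linarith) hU hkill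
  obtain ⟨m, hm0, hm⟩ := exists_integral_jumpLaw (N := N) hp hs hs'
  have hzint := integrable_jumpLaw (N := N) hp hs hs'
  obtain ⟨hKi, hKle⟩ := hK (ε / G) (by positivity)
  set u := (G / M) ^ γ with hu
  have hu0 : 0 ≤ u := by positivity
  have hlin_int : ∀ q : E N, Integrable (fun z : truncCone N p 1 (e₁ N) ↦
      ⟪y, ε • dirRotation N q (z : E N)⟫) P := fun q ↦
    (((dirRotation N q).toContinuousLinearEquiv.integrable_comp_iff.mpr hzint).smul ε).const_inner y
  have hlin : ∀ q : E N, ‖q‖ = 1 → ∫ z : truncCone N p 1 (e₁ N),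
      ⟪y, ε • dirRotation N q (z : E N)⟫ ∂P = ε * m * ⟪y, q⟫ := by
    intro q hq
    have hInt : Integrable (fun z : truncCone N p 1 (e₁ N) ↦ ε • dirRotation N q (z : E N)) P :=
      ((dirRotation N q).toContinuousLinearEquiv.integrable_comp_iff.mpr hzint).smul ε
    have h1 : ∫ z : truncCone N p 1 (e₁ N), dirRotation N q (z : E N) ∂P = m • q := by
      have := (dirRotation N q).toContinuousLinearEquiv.integral_comp_comm (μ := P)
        (fun z : truncCone N p 1 (e₁ N) ↦ (z : E N))
      rw [hm, map_smul] at this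
      refine this.trans ?_
      change m • dirRotation N q (e₁ N) = _
      rw [dirRotation_e₁ hq]
    rw [integral_inner hInt, integral_smul, h1, inner_smul_right, inner_smul_right]; ring
  have hexp_int : ∀ q : E N, Integrable (fun z : truncCone N p 1 (e₁ N) ↦
      1 + γ * (-(a * ⟪y, ε • dirRotation N q (z : E N)⟫) + 10 * sqMin (ε / G * ‖(z : E N)‖))) P :=
    fun q ↦ (integrable_const 1).add
      ((((hlin_int q).const_mul a).neg.add (hKi.const_mul 10)).const_mul γ)
  have hexp : ∀ q : E N, ‖q‖ = 1 → ∫ z : truncCone N p 1 (e₁ N),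
      (1 + γ * (-(a * ⟪y, ε • dirRotation N q (z : E N)⟫) + 10 * sqMin (ε / G * ‖(z : E N)‖))) ∂P =
      1 + γ * (-(a * (ε * m * ⟪y, q⟫)) + 10 * ∫ z : truncCone N p 1 (e₁ N),
        sqMin (ε / G * ‖(z : E N)‖) ∂P) := by
    intro q hq
    have h1 : Integrable (fun z : truncCone N p 1 (e₁ N) ↦
        -(a * ⟪y, ε • dirRotation N q (z : E N)⟫)) P := ((hlin_int q).const_mul a).neg
    have h2 : Integrable (fun z : truncCone N p 1 (e₁ N) ↦
        γ * (-(a * ⟪y, ε • dirRotation N q (z : E N)⟫) + 10 * sqMin (ε / G * ‖(z : E N)‖))) P :=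
      (h1.add (hKi.const_mul 10)).const_mul γ
    rw [integral_add (integrable_const _) h2, integral_const_mul,
      integral_add h1 (hKi.const_mul 10), integral_neg, integral_const_mul, integral_const_mul,
      hlin q hq]
    simp
  have hnorm : ∀ (q : E N) (z : truncCone N p 1 (e₁ N)),
      ‖ε • dirRotation N q (z : E N)‖ / G = ε / G * ‖(z : E N)‖ := by
    intro q z
    rw [norm_smul, LinearIsometryEquiv.norm_map, Real.norm_of_nonneg hε0.le]; ring
  -- The jumps that carry Player I into the killing ball: `2G / (3ε)` is the distance to the centre
  -- in units of `ε`, and `3ε ≤ G` makes it at least `2`.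
  set B : Set (truncCone N p 1 (e₁ N)) :=
    {z | (z : E N) ∈ ball ((2 * G / (3 * ε)) • e₁ N) (κ * (2 * G / (3 * ε)))} with hB
  have hBm : MeasurableSet B := measurable_subtype_coe measurableSet_ball
  have hBmem : ∀ z : truncCone N p 1 (e₁ N), z ∈ B ↔
      x + ε • dirRotation N y (z : E N) ∈ ball ((G / 3) • e) (2 / 3 * κ * G) := by
    intro z
    have h1 : x + ε • dirRotation N y (z : E N) - (G / 3) • e =
        ε • dirRotation N y ((z : E N) - (2 * G / (3 * ε)) • e₁ N) := by
      rw [map_sub, map_smul, dirRotation_e₁ hynorm, ← add_smul_pullDir hx, smul_sub, smul_smul,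
        show ε * (2 * G / (3 * ε)) = 2 / 3 * G by field_simp]
      abel
    simp only [hB, mem_ofPred_eq, mem_ball, dist_eq_norm, h1, norm_smul,
      LinearIsometryEquiv.norm_map, Real.norm_of_nonneg hε0.le]
    have h2 : 2 / 3 * κ * G = ε * (κ * (2 * G / (3 * ε))) := by field_simp
    rw [h2, mul_lt_mul_iff_right₀ hε0]
  have hprob : c * (ε / G) ^ (2 * s) ≤ P.real B := by
    refine le_trans ?_ (hc (2 * G / (3 * ε)) ?_)
    · gcongr
      rw [Real.rpow_neg (by positivity), ← Real.inv_rpow (by positivity), inv_div]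
      apply Real.rpow_le_rpow (by positivity) _ (by linarith)
      rw [div_le_div_iff₀ hx (by positivity)]
      nlinarith
    · rw [le_div_iff₀ (by positivity)]; linarith
  have hI : ∫ z : truncCone N p 1 (e₁ N), U (x + ε • dirRotation N y (z : E N)) ∂P ≤
      u * (1 + γ * (-(a * (ε * m)) + 10 * (K * (ε / G) ^ (2 * s))) -
        1 / 6 * (c * (ε / G) ^ (2 * s))) := by
    have hb2 : Integrable (B.indicator fun _ ↦ (1 / 6 : ℝ)) P :=
      (integrable_const _).indicator hBm
    calc _ ≤ ∫ z : truncCone N p 1 (e₁ N), u * ((1 + γ * (-(a *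
          ⟪y, ε • dirRotation N y (z : E N)⟫) + 10 * sqMin (ε / G * ‖(z : E N)‖))) -
            B.indicator (fun _ ↦ (1 / 6 : ℝ)) z) ∂P := by
          refine integral_mono_of_nonneg (.of_forall fun z ↦ hU0 _)
            (((hexp_int y).sub hb2).const_mul u) (.of_forall fun z ↦ ?_)
          have h1 := hstep (ε • dirRotation N y (z : E N))
          rw [hnorm] at h1
          refine h1.trans_eq ?_
          congr 2
          by_cases hz : z ∈ B
          · rw [indicator_of_mem hz, indicator_of_mem]
            exact (hBmem z).mp hz
          · rw [indicator_of_notMem hz, indicator_of_notMem]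
            exact fun h ↦ hz ((hBmem z).mpr h)
      _ = u * (1 + γ * (-(a * (ε * m)) + 10 * ∫ z : truncCone N p 1 (e₁ N),
            sqMin (ε / G * ‖(z : E N)‖) ∂P) - 1 / 6 * P.real B) := by
          rw [integral_const_mul, integral_sub (hexp_int y) hb2, integral_indicator_const _ hBm,
            hexp y hynorm, real_inner_self_eq_norm_sq, hynorm, smul_eq_mul]
          ring
      _ ≤ _ := by gcongr
  -- Player II does the most harm by pulling in direction `-y`, which costs exactly the drift `a ε
  -- m` that Player I gains. The killing term is discarded.
  have hII : ∫ z : truncCone N p 1 (e₁ N), U (x + ε • dirRotation N y' (z : E N)) ∂P ≤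
      u * (1 + γ * (a * (ε * m) + 10 * (K * (ε / G) ^ (2 * s)))) := by
    calc _ ≤ ∫ z : truncCone N p 1 (e₁ N), u * (1 + γ * (-(a *
          ⟪y, ε • dirRotation N y' (z : E N)⟫) + 10 * sqMin (ε / G * ‖(z : E N)‖))) ∂P := by
          refine integral_mono_of_nonneg (.of_forall fun z ↦ hU0 _)
            ((hexp_int y').const_mul u) (.of_forall fun z ↦ ?_)
          have h1 := hstep (ε • dirRotation N y' (z : E N))
          rw [hnorm] at h1
          refine h1.trans (mul_le_mul_of_nonneg_left ?_ hu0)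
          exact sub_le_self _ (indicator_nonneg (fun _ _ ↦ by norm_num) _)
      _ = u * (1 + γ * (-(a * (ε * m * ⟪y, y'⟫)) + 10 * ∫ z : truncCone N p 1 (e₁ N),
            sqMin (ε / G * ‖(z : E N)‖) ∂P)) := by
          rw [integral_const_mul, hexp y' hy']
      _ ≤ _ := by
          have h1 : -1 ≤ ⟪y, y'⟫ := by
            have := (abs_le.mp (abs_real_inner_le_norm y y')).1
            rwa [hynorm, hy', one_mul] at this
          have h2 : -(a * (ε * m * ⟪y, y'⟫)) ≤ a * (ε * m) := by
            have := mul_le_mul_of_nonneg_left h1 (show 0 ≤ a * (ε * m) by positivity)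
            linarith
          gcongr
  have hpow : 0 ≤ (ε / G) ^ (2 * s) := by positivity
  -- The two errors of `10 γ K` against the gain `c / 6`: this is the condition `120 γ K ≤ c`.
  have hfin : 20 * γ * (K * (ε / G) ^ (2 * s)) - 1 / 6 * (c * (ε / G) ^ (2 * s)) ≤ 0 := by
    nlinarith
  nlinarith [mul_le_mul_of_nonneg_left hfin hu0]

/-! ### The game process -/

/-- `f` factors through the first `n` coordinates, the others being filled with a fixed point, and
disjoint blocks of coordinates are independent. -/
lemma indepFun_eval_infinitePi {α β : Type*} [MeasurableSpace α] [MeasurableSpace β]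
    (P : Measure α) [IsProbabilityMeasure P] {n : ℕ} {f : (ℕ → α) → β} (hf : Measurable f)
    (hdep : ∀ ω ω' : ℕ → α, (∀ i < n, ω i = ω' i) → f ω = f ω') :
    IndepFun f (fun ω ↦ ω n) (Measure.infinitePi fun _ ↦ P) := by
  obtain ⟨o⟩ := nonempty_of_isProbabilityMeasure P
  set ext : (Finset.range n → α) → ℕ → α :=
    fun r i ↦ if h : i ∈ Finset.range n then r ⟨i, h⟩ else o
  have hext : Measurable ext := by
    refine measurable_pi_lambda _ fun i ↦ ?_
    by_cases h : i ∈ Finset.range n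
    · simp only [ext, h, dite_true]
      exact measurable_pi_apply (X := fun _ : Finset.range n ↦ α) ⟨i, h⟩
    · simp only [ext, h, dite_false]
      exact measurable_const
  have hind := (iIndepFun_infinitePi (P := fun _ : ℕ ↦ P) (X := fun _ a ↦ a)
    fun _ ↦ measurable_id).indepFun_finset (Finset.range n) {n} (by simp)
    (fun i ↦ measurable_pi_apply i)
  have := hind.comp (hf.comp hext)
    (measurable_pi_apply (⟨n, Finset.mem_singleton_self n⟩ : ({n} : Finset ℕ)))
  convert this using 1
  · ext ω
    refine hdep _ _ fun i hi ↦ ?_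
    simp [ext, hi]
  · rfl

section Game

variable {N : ℕ} [N.AtLeastTwo] {p : ℝ}

lemma measurable_last (n : ℕ) : Measurable (History.last : History N p n → E N) := by
  cases n with
  | zero => exact measurable_fst
  | succ n =>
    exact measurable_fst.comp ((measurable_pi_apply (Fin.last n)).comp measurable_snd)

/-- The position after one more round with outcome `o`, given the history `h`. -/
def nextPosition (ε : ℝ) (σI σII : Strategy N p) (n : ℕ) (h : History N p n)
    (o : Outcome N p) : E N :=
  h.last + ε • dirRotation N ((if o.2 then σI.move n h else σII.move n h : sphere (0 : E N) 1) : E N)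
    (o.1 : E N)

lemma measurable_nextPosition (ε : ℝ) (σI σII : Strategy N p) (n : ℕ) :
    Measurable fun q : History N p n × Outcome N p ↦ nextPosition ε σI σII n q.1 q.2 := by
  have hy : Measurable fun q : History N p n × Outcome N p ↦
      (if q.2.2 then σI.move n q.1 else σII.move n q.1 : sphere (0 : E N) 1) := by
    refine Measurable.ite ?_ ((σI.measurable_move n).comp measurable_fst)
      ((σII.measurable_move n).comp measurable_fst)
    exact (measurable_snd.comp measurable_snd) (measurableSet_singleton true)
  have hz : Measurable fun q : History N p n × Outcome N p ↦ (q.2.1 : E N) :=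
    measurable_subtype_coe.comp (measurable_fst.comp measurable_snd)
  have hrot := (measurable_dirRotation N).comp ((measurable_subtype_coe.comp hy).prodMk hz)
  have hlast : Measurable fun q : History N p n × Outcome N p ↦ q.1.last :=
    (measurable_last n).comp measurable_fst
  exact hlast.add (hrot.const_smul ε)

variable (ε : ℝ) (x : E N) (σI σII : Strategy N p)

lemma position_succ (n : ℕ) (ω : ℕ → Outcome N p) : position ε x σI σII (n + 1) ω =
    nextPosition ε σI σII n (gameHistory ε x σI σII n ω) (ω n) := by
  simp [position, gameHistory, nextPosition, History.last]

lemma gameHistory_succ (n : ℕ) (ω : ℕ → Outcome N p) : gameHistory ε x σI σII (n + 1) ω =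
    (x, Fin.snoc (gameHistory ε x σI σII n ω).2
      (nextPosition ε σI σII n (gameHistory ε x σI σII n ω) (ω n), ω n)) := rfl

lemma measurable_gameHistory (n : ℕ) : Measurable (gameHistory ε x σI σII n) := by
  induction n with
  | zero => exact measurable_const
  | succ n ih =>
    simp only [funext (gameHistory_succ ε x σI σII n)]
    refine measurable_const.prodMk (measurable_pi_lambda _ fun i ↦ ?_)
    induction i using Fin.lastCases with
    | last =>
      simp only [Fin.snoc_last]
      exact ((measurable_nextPosition ε σI σII n).comp (ih.prodMk (measurable_pi_apply n))).prodMk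
        (measurable_pi_apply n)
    | cast i =>
      simp only [Fin.snoc_castSucc]
      exact (measurable_pi_apply i).comp (measurable_snd.comp ih)

lemma measurable_position (n : ℕ) : Measurable (position ε x σI σII n) :=
  (measurable_last n).comp (measurable_gameHistory ε x σI σII n)

lemma gameHistory_congr (n : ℕ) {ω ω' : ℕ → Outcome N p} (h : ∀ i < n, ω i = ω' i) :
    gameHistory ε x σI σII n ω = gameHistory ε x σI σII n ω' := by
  induction n with
  | zero => rfl
  | succ n ih =>
    rw [gameHistory_succ, gameHistory_succ, ih fun i hi ↦ h i (by lia), h n (by lia)]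

open Classical in
/-- The game position stopped at the exit from `D`. -/
def stoppedPosition (D : Set (E N)) : ℕ → (ℕ → Outcome N p) → E N
  | 0, _ => x
  | n + 1, ω => if stoppedPosition D n ω ∈ D then position ε x σI σII (n + 1) ω
      else stoppedPosition D n ω

variable {D : Set (E N)}

lemma measurable_stoppedPosition (hD : MeasurableSet D) (n : ℕ) :
    Measurable (stoppedPosition ε x σI σII D n) := by
  induction n with
  | zero => exact measurable_const
  | succ n ih => exact Measurable.ite (ih hD) (measurable_position ε x σI σII (n + 1)) ih

lemma stoppedPosition_congr (n : ℕ) {ω ω' : ℕ → Outcome N p} (h : ∀ i < n, ω i = ω' i) :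
    stoppedPosition ε x σI σII D n ω = stoppedPosition ε x σI σII D n ω' := by
  induction n with
  | zero => rfl
  | succ n ih =>
    simp only [stoppedPosition, position]
    rw [ih fun i hi ↦ h i (by lia), gameHistory_congr ε x σI σII (n + 1) h]

/-- A stopped position is frozen outside `D`, so lying in `D` shows that no stopping has occurred.
-/
lemma stoppedPosition_eq_of_mem (n : ℕ) (ω : ℕ → Outcome N p)
    (h : stoppedPosition ε x σI σII D n ω ∈ D) :
    stoppedPosition ε x σI σII D n ω = position ε x σI σII n ω := by
  cases n with
  | zero => rfl
  | succ n =>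
    by_cases hn : stoppedPosition ε x σI σII D n ω ∈ D
    · simp [stoppedPosition, hn]
    · simp [stoppedPosition, hn] at h

/-- `exitTime` ignores time `0` whereas `stoppedPosition` tests it; starting in `D` reconciles the
two. -/
lemma stoppedPosition_eq_position (hx : x ∈ D) (n : ℕ) (ω : ℕ → Outcome N p)
    (h : ∀ j, 1 ≤ j → j < n → position ε x σI σII j ω ∈ D) :
    stoppedPosition ε x σI σII D n ω = position ε x σI σII n ω := by
  induction n with
  | zero => rfl
  | succ n ih =>
    have ihn := ih fun j h1 h2 ↦ h j h1 (by lia)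
    have hmem : stoppedPosition ε x σI σII D n ω ∈ D := by
      rw [ihn]
      rcases Nat.eq_zero_or_pos n with rfl | hn
      · exact hx
      · exact h n hn (by lia)
    simp [stoppedPosition, hmem]

/-! ### The supermartingale argument -/

variable {s : ℝ}

instance : IsProbabilityMeasure (uniformOn (univ : Set Bool)) :=
  isProbabilityMeasure_uniformOn finite_univ univ_nonempty

lemma integral_outcomeLaw [IsProbabilityMeasure (jumpLaw N p s)] {f : Outcome N p → ℝ}
    (hf : Integrable f (outcomeLaw N p s)) :
    ∫ o, f o ∂outcomeLaw N p s =
      ((∫ z, f (z, true) ∂jumpLaw N p s) + ∫ z, f (z, false) ∂jumpLaw N p s) / 2 := by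
  have hhalf : ∀ b : Bool, (uniformOn (univ : Set Bool)).real {b} = 1 / 2 := by
    intro b
    rw [measureReal_def, uniformOn_univ]
    simp
  rw [outcomeLaw, integral_prod_symm _ hf, integral_fintype (.of_finite)]
  simp only [Fintype.sum_bool, hhalf, smul_eq_mul]
  ring

/-- If the expected value of `V` does not increase in one round, then neither does that of `V` at
the stopped position. -/
lemma integral_stoppedPosition_le [IsProbabilityMeasure (jumpLaw N p s)] (hD : MeasurableSet D)
    {V : E N → ℝ} (hV : Measurable V) (hV0 : ∀ z, 0 ≤ V z) (hV1 : ∀ z, V z ≤ 1)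
    (hstep : ∀ n (h : History N p n), h.last ∈ D →
      (∫ z : truncCone N p 1 (e₁ N),
        V (h.last + ε • dirRotation N (σI.move n h : E N) (z : E N)) ∂jumpLaw N p s) +
      (∫ z : truncCone N p 1 (e₁ N),
        V (h.last + ε • dirRotation N (σII.move n h : E N) (z : E N)) ∂jumpLaw N p s) ≤
      2 * V h.last) (n : ℕ) :
    ∫ ω, V (stoppedPosition ε x σI σII D n ω) ∂gameMeasure N p s ≤ V x := by
  classical
  have : IsProbabilityMeasure (outcomeLaw N p s) := by unfold outcomeLaw; infer_instance
  have hPg : IsProbabilityMeasure (gameMeasure N p s) := by unfold gameMeasure; infer_instance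
  have hbdd : ∀ {α : Type _} [MeasurableSpace α] (μ : Measure α) [IsProbabilityMeasure μ]
      {f : α → E N}, Measurable f → Integrable (fun a ↦ V (f a)) μ := by
    intro α _ μ _ f hf
    refine (integrable_const (1 : ℝ)).mono' (hV.comp hf).aestronglyMeasurable
      (.of_forall fun a ↦ ?_)
    rw [Real.norm_of_nonneg (hV0 _)]; exact hV1 _
  induction n with
  | zero => simp [stoppedPosition]
  | succ n ih =>
    refine le_trans ?_ ih
    -- The past `st` is independent of the next outcome. Fubini thus replaces conditional
    -- expectation, and `hstep` is applied to each fixed history.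
    set st : (ℕ → Outcome N p) → History N p n × E N :=
      fun ω ↦ (gameHistory ε x σI σII n ω, stoppedPosition ε x σI σII D n ω)
    have hst : Measurable st :=
      (measurable_gameHistory ε x σI σII n).prodMk (measurable_stoppedPosition ε x σI σII hD n)
    have hPst : IsProbabilityMeasure ((gameMeasure N p s).map st) :=
      Measure.isProbabilityMeasure_map hst.aemeasurable
    set Φ : (History N p n × E N) × Outcome N p → E N :=
      fun q ↦ if q.1.2 ∈ D then nextPosition ε σI σII n q.1.1 q.2 else q.1.2
    have hΦ : Measurable Φ := by
      refine Measurable.ite ?_ ?_ ?_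
      · exact (measurable_snd.comp measurable_fst) hD
      · exact (measurable_nextPosition ε σI σII n).comp
          ((measurable_fst.comp measurable_fst).prodMk measurable_snd)
      · exact measurable_snd.comp measurable_fst
    have hind : IndepFun st (fun ω ↦ ω n) (gameMeasure N p s) := by
      refine indepFun_eval_infinitePi _ hst fun ω ω' h ↦ ?_
      simp only [st]
      rw [gameHistory_congr ε x σI σII n h, stoppedPosition_congr ε x σI σII n h]
    have hmap : (gameMeasure N p s).map (fun ω ↦ (st ω, ω n)) =
        ((gameMeasure N p s).map st).prod (outcomeLaw N p s) := by
      rw [hind.map_prod_eq_prod_map_map hst.aemeasurable (measurable_pi_apply n).aemeasurable]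
      congr 1
      exact Measure.infinitePi_map_eval _ n
    have heq : ∀ ω, V (stoppedPosition ε x σI σII D (n + 1) ω) = V (Φ (st ω, ω n)) := by
      intro ω
      simp only [stoppedPosition, position_succ, Φ, st]
    simp_rw [heq]
    rw [← integral_map (φ := fun ω ↦ (st ω, ω n)) (f := fun q ↦ V (Φ q))
      (hst.prodMk (measurable_pi_apply n)).aemeasurable (hV.comp hΦ).aestronglyMeasurable, hmap,
      integral_prod _ (hbdd _ hΦ), integral_map hst.aemeasurable
        (hbdd _ hΦ).integral_prod_left.aestronglyMeasurable]
    refine integral_mono ?_ (hbdd _ (measurable_stoppedPosition ε x σI σII hD n)) fun ω ↦ ?_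
    · have := (hbdd (((gameMeasure N p s).map st).prod (outcomeLaw N p s)) hΦ).integral_prod_left
      exact this.comp_measurable hst
    · by_cases hω : stoppedPosition ε x σI σII D n ω ∈ D
      · have hlast : (gameHistory ε x σI σII n ω).last = stoppedPosition ε x σI σII D n ω :=
          (stoppedPosition_eq_of_mem ε x σI σII n ω hω).symm
        simp only [Φ, st, hω, if_true]
        have hnext : Measurable
            (nextPosition ε σI σII n (gameHistory ε x σI σII n ω)) :=
          (measurable_nextPosition ε σI σII n).comp (measurable_const.prodMk measurable_id)
        rw [integral_outcomeLaw (hbdd _ hnext)]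
        have := hstep n (gameHistory ε x σI σII n ω) (by rw [hlast]; exact hω)
        simp only [nextPosition, if_true, Bool.false_eq_true, if_false]
        rw [← hlast]
        linarith
      · simp [Φ, st, hω]

/-- The game leaves a bounded set almost surely, by a single long jump. -/
lemma gameMeasure_forall_mem (hp : 2 ≤ p) (hs : 1 / 2 < s) (hs' : s < 1)
    (hε : 0 < ε) (hD : Bornology.IsBounded D) (hx : x ∈ D) :
    gameMeasure N p s {ω | ∀ n, 1 ≤ n → position ε x σI σII n ω ∈ D} = 0 := by
  have := isProbabilityMeasure_jumpLaw (N := N) hp hs hs'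
  have : IsProbabilityMeasure (outcomeLaw N p s) := by unfold outcomeLaw; infer_instance
  obtain ⟨C, hC⟩ := Metric.isBounded_iff.mp hD
  set A : Set (Outcome N p) := {o | ‖(o.1 : E N)‖ ≤ C / ε}
  have hA : MeasurableSet A := measurableSet_le (by fun_prop) measurable_const
  have hms : MeasurableSet {z : truncCone N p 1 (e₁ N) | ‖(z : E N)‖ ≤ C / ε} :=
    measurableSet_le (by fun_prop) measurable_const
  have hAlt : outcomeLaw N p s A < 1 := by
    refine lt_of_eq_of_lt ?_ (jumpLaw_norm_le_lt_one (N := N) hp hs hs' (C / ε))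
    exact (measurePreserving_fst (μ := jumpLaw N p s)
      (ν := uniformOn (univ : Set Bool))).measure_preimage hms.nullMeasurableSet
  -- Remaining in `D` forces every jump to satisfy `‖z‖ ≤ C / ε`, and the outcomes are independent.
  have hle : ∀ n : ℕ, gameMeasure N p s {ω | ∀ n, 1 ≤ n → position ε x σI σII n ω ∈ D} ≤
      outcomeLaw N p s A ^ n := by
    intro n
    have h1 : gameMeasure N p s (Set.pi (Finset.range n) fun _ ↦ A) = outcomeLaw N p s A ^ n := by
      rw [gameMeasure, Measure.infinitePi_pi _ fun _ _ ↦ hA]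
      simp
    rw [← h1]
    refine measure_mono fun ω hω i _ ↦ ?_
    have hi : position ε x σI σII i ω ∈ D := by
      rcases Nat.eq_zero_or_pos i with rfl | hi
      · exact hx
      · exact hω i hi
    have hd := hC (hω (i + 1) (by lia)) hi
    rw [position_succ, nextPosition, dist_eq_norm] at hd
    change ‖position ε x σI σII i ω + _ - position ε x σI σII i ω‖ ≤ C at hd
    rw [add_sub_cancel_left, norm_smul, LinearIsometryEquiv.norm_map,
      Real.norm_of_nonneg hε.le] at hd
    change ‖((ω i).1 : E N)‖ ≤ C / ε
    rw [le_div_iff₀ hε]; linarith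
  refine le_antisymm (ge_of_tendsto' (ENNReal.tendsto_pow_atTop_nhds_zero_of_lt_one hAlt) hle)
    zero_le

/-- The exit probability controlled by a barrier. -/
lemma one_sub_le_of_barrier (hp : 2 ≤ p) (hs : 1 / 2 < s) (hs' : s < 1) (hε : 0 < ε)
    (hD : MeasurableSet D) (hDb : Bornology.IsBounded D) (hx : x ∈ D) {x₀ : E N} {δ : ℝ}
    {V : E N → ℝ} (hV : Measurable V) (hV0 : ∀ z, 0 ≤ V z) (hV1 : ∀ z, V z ≤ 1)
    (hVout : ∀ z ∉ ball x₀ δ, 1 ≤ V z)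
    (hstep : ∀ n (h : History N p n), h.last ∈ D →
      (∫ z : truncCone N p 1 (e₁ N),
        V (h.last + ε • dirRotation N (σI.move n h : E N) (z : E N)) ∂jumpLaw N p s) +
      (∫ z : truncCone N p 1 (e₁ N),
        V (h.last + ε • dirRotation N (σII.move n h : E N) (z : E N)) ∂jumpLaw N p s) ≤
      2 * V h.last) :
    1 - V x ≤ (gameMeasure N p s).real
      {ω | exitTime D ε x σI σII ω < ⊤ ∧ exitPosition D ε x σI σII ω ∈ ball x₀ δ} := by
  have := isProbabilityMeasure_jumpLaw (N := N) hp hs hs'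
  have : IsProbabilityMeasure (outcomeLaw N p s) := by unfold outcomeLaw; infer_instance
  have hPg : IsProbabilityMeasure (gameMeasure N p s) := by unfold gameMeasure; infer_instance
  set good := {ω | exitTime D ε x σI σII ω < ⊤ ∧ exitPosition D ε x σI σII ω ∈ ball x₀ δ}
  -- Bad exits by time `n`. Markov's inequality at level `1` bounds each event, and monotonicity
  -- passes the bound to the union.
  set A : ℕ → Set (ℕ → Outcome N p) := fun n ↦ {ω | stoppedPosition ε x σI σII D n ω ∉ D ∧
    stoppedPosition ε x σI σII D n ω ∉ ball x₀ δ}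
  have hAmono : Monotone A := by
    refine monotone_nat_of_le_succ fun n ω hω ↦ ?_
    have h1 : stoppedPosition ε x σI σII D (n + 1) ω = stoppedPosition ε x σI σII D n ω := by
      simp [stoppedPosition, hω.1]
    change _ ∉ D ∧ _ ∉ ball x₀ δ
    rw [h1]
    exact hω
  have hAle : ∀ n, gameMeasure N p s (A n) ≤ ENNReal.ofReal (V x) := by
    intro n
    have hInt : Integrable (fun ω ↦ V (stoppedPosition ε x σI σII D n ω)) (gameMeasure N p s) := by
      refine (integrable_const (1 : ℝ)).mono' (hV.comp
        (measurable_stoppedPosition ε x σI σII hD n)).aestronglyMeasurable (.of_forall fun a ↦ ?_)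
      rw [Real.norm_of_nonneg (hV0 _)]; exact hV1 _
    have h1 := mul_meas_ge_le_integral_of_nonneg (.of_forall fun ω ↦ hV0 _) hInt 1
    have h2 := integral_stoppedPosition_le ε x σI σII hD hV hV0 hV1 hstep n
    rw [← ofReal_measureReal]
    refine ENNReal.ofReal_le_ofReal ?_
    refine le_trans (measureReal_mono fun ω hω ↦ ?_) ((one_mul _).symm.le.trans (h1.trans h2))
    exact hVout _ hω.2
  have hsub : goodᶜ ⊆ {ω | ∀ n, 1 ≤ n → position ε x σI σII n ω ∈ D} ∪ ⋃ n, A n := by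
    intro ω hω
    by_cases htop : exitTime D ε x σI σII ω = ⊤
    · left
      rw [exitTime, hittingAfter_eq_top_iff] at htop
      exact fun n hn ↦ not_not.mp (htop n hn)
    · right
      have hmem : exitPosition D ε x σI σII ω ∈ Dᶜ := hittingAfter_mem_set_of_ne_top htop
      have hnb : exitPosition D ε x σI σII ω ∉ ball x₀ δ :=
        fun h ↦ hω ⟨lt_top_iff_ne_top.mpr htop, h⟩
      obtain ⟨k, hk⟩ := WithTop.ne_top_iff_exists.mp htop
      have hpos : exitPosition D ε x σI σII ω = position ε x σI σII k ω := by
        rw [exitPosition, stoppedValue, ← hk]; rfl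
      have hstopped := stoppedPosition_eq_position ε x σI σII hx k ω fun j h1 h2 ↦ not_not.mp
        (notMem_of_lt_hittingAfter (u := position ε x σI σII) (s := Dᶜ) (n := 1) (ω := ω) (k := j)
          (by
            change (j : WithTop ℕ) < exitTime D ε x σI σII ω
            rw [← hk]; exact WithTop.coe_lt_coe.mpr h2) h1)
      refine mem_iUnion.mpr ⟨k, ?_⟩
      change _ ∉ D ∧ _ ∉ ball x₀ δ
      rw [hstopped, ← hpos]
      exact ⟨hmem, hnb⟩
  have hbad : gameMeasure N p s goodᶜ ≤ ENNReal.ofReal (V x) := by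
    refine (measure_mono hsub).trans ((measure_union_le _ _).trans ?_)
    rw [gameMeasure_forall_mem ε x σI σII hp hs hs' hε hDb hx, zero_add,
      hAmono.measure_iUnion]
    exact iSup_le hAle
  have hone : (1 : ℝ) ≤ (gameMeasure N p s).real good + (gameMeasure N p s).real goodᶜ := by
    have := measureReal_union_le (μ := gameMeasure N p s) good goodᶜ
    rwa [union_compl_self, probReal_univ] at this
  have : (gameMeasure N p s).real goodᶜ ≤ V x := ENNReal.toReal_le_of_le_ofReal (hV0 x) hbad
  linarith

end Game

/-! ### The barrier and the strategy of Player I -/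

section Barrier

variable {N : ℕ}

open Classical in
/-- The barrier: a small power of the gauge with vertex `v`, set to zero at the successful exit
positions. -/
def barrier (D : Set (E N)) (x₀ e v : E N) (δ M γ : ℝ) (z : E N) : ℝ :=
  if z ∉ D ∧ z ∈ ball x₀ δ then 0 else min 1 ((coneGauge e (z - v) / M) ^ γ)

variable {D : Set (E N)} {x₀ e v : E N} {δ M γ : ℝ}

lemma measurable_barrier (hD : MeasurableSet D) : Measurable (barrier D x₀ e v δ M γ) := by
  refine Measurable.ite (hD.compl.inter measurableSet_ball) measurable_const
    (measurable_const.min (Measurable.pow_const ?_ γ))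
  exact ((continuous_coneGauge e).measurable.comp (measurable_id.sub_const v)).div_const M

lemma coneGauge_nonneg (he : ‖e‖ = 1) (z : E N) : 0 ≤ coneGauge e z :=
  (norm_nonneg _).trans (norm_le_coneGauge he _)

lemma barrier_nonneg (he : ‖e‖ = 1) (hM : 0 < M) (z : E N) : 0 ≤ barrier D x₀ e v δ M γ z := by
  have := coneGauge_nonneg he (z - v)
  unfold barrier
  split_ifs <;> positivity

lemma barrier_le_one (z : E N) : barrier D x₀ e v δ M γ z ≤ 1 := by
  unfold barrier
  split_ifs
  · exact zero_le_one
  · exact min_le_left _ _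

lemma barrier_le_rpow (he : ‖e‖ = 1) (hM : 0 < M) (z : E N) :
    barrier D x₀ e v δ M γ z ≤ (coneGauge e (z - v) / M) ^ γ := by
  have := coneGauge_nonneg he (z - v)
  unfold barrier
  split_ifs
  · positivity
  · exact min_le_right _ _

end Barrier

section PullStrategy

variable {N : ℕ} [N.AtLeastTwo] {p : ℝ}

open Classical in
/-- The strategy of pulling towards the centre of the level sphere of the gauge with vertex `v`
and axis `e`. -/
def pullStrategy (e v : E N) (he : ‖e‖ = 1) : Strategy N p where
  move n h := ⟨if 0 < coneGauge e (h.last - v) then pullDir e (h.last - v) else e, by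
    rw [mem_sphere_zero_iff_norm]
    split_ifs with hG
    · exact norm_pullDir he hG
    · exact he⟩
  measurable_move n := by
    have hl : Measurable fun h : History N p n ↦ h.last - v := (measurable_last n).sub_const v
    have hG : Measurable fun h : History N p n ↦ coneGauge e (h.last - v) :=
      (continuous_coneGauge e).measurable.comp hl
    refine Measurable.subtype_mk (Measurable.ite (measurableSet_lt measurable_const hG) ?_
      measurable_const)
    unfold pullDir
    exact (measurable_const.div (hG.const_mul 2)).smul
      (((hG.div_const 3).smul_const e).sub hl)

lemma pullStrategy_move {e v : E N} (he : ‖e‖ = 1) {n : ℕ} (h : History N p n)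
    (hG : 0 < coneGauge e (h.last - v)) :
    ((pullStrategy e v he).move n h : E N) = pullDir e (h.last - v) :=
  if_pos hG

end PullStrategy

/-- A point that is the vertex of a cone outside `D` is game-regular. -/
theorem gameRegular_of_exteriorCone {N : ℕ} [N.AtLeastTwo] {p s : ℝ} (hp : 2 ≤ p) (hs : 1 / 2 < s)
    (hs' : s < 1) {D : Set (E N)} (hD_open : IsOpen D) (hD_bdd : Bornology.IsBounded D)
    {x₀ e : E N} (he : ‖e‖ = 1) {κ₀ h : ℝ} (hκ₀ : 0 < κ₀) (hκ₀4 : κ₀ ≤ 1 / 4) (hh : 0 < h)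
    (hcone : ∀ (r : ℝ) (w : E N), 0 < r → ‖w‖ ≤ κ₀ * r → ‖r • e + w‖ < h →
      x₀ + (r • e + w) ∉ D) :
    GameRegular p s D x₀ := by
  intro ξ hξ δ hδ
  have := isProbabilityMeasure_jumpLaw (N := N) hp hs hs'
  obtain ⟨K, hK0, hK⟩ := exists_integral_sqMin_le (N := N) hp hs hs'
  -- With `κ ≤ κ₀ / 2` the killing radius `2κG/3` is at most `κ₀ G / 3`, so the killing ball fits in
  -- the cone.
  obtain ⟨κ, hκ, hκκ₀, hκ4, c, hc0, hc⟩ :=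
    exists_jumpLaw_ball_ge (N := N) hp hs hs' (half_pos hκ₀)
  set γ := min 1 (c / (120 * K)) with hγdef
  have hγ0 : 0 < γ := lt_min one_pos (by positivity)
  have hγ1 : γ ≤ 1 := min_le_left _ _
  have hγ : 120 * γ * K ≤ c := by
    have : γ ≤ c / (120 * K) := min_le_right _ _
    rw [le_div_iff₀ (by positivity)] at this
    linarith
  set M := min δ h / 4 with hMdef
  have hM : 0 < M := div_pos (lt_min hδ hh) (by norm_num)
  have hMδ : 4 * M ≤ δ := by have := min_le_left δ h; linarith
  have hMh : 4 * M ≤ h := by have := min_le_right δ h; linarith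
  -- The starting gauge is at most `3 · 2r`, so this `r` makes the initial barrier `(6r / M) ^ γ` at
  -- most `ξ`.
  set r := min M (M * ξ ^ (1 / γ) / 6) with hrdef
  have hr : 0 < r := lt_min hM (by positivity)
  have hrM : r ≤ M := min_le_left _ _
  have hrξ : 6 * r / M ≤ ξ ^ (1 / γ) := by
    have : r ≤ M * ξ ^ (1 / γ) / 6 := min_le_right _ _
    rw [div_le_iff₀ hM]; linarith
  set v := x₀ + r • e with hv
  have hre : ‖r • e‖ = r := by rw [norm_smul, he, Real.norm_of_nonneg hr.le, mul_one]
  -- The ball of radius `κ₀ r` about `v` lies in the exterior cone, and the gauge dominates the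
  -- norm.
  have hfar : ∀ q ∈ D, κ₀ * r ≤ coneGauge e (q - v) := by
    intro q hq
    refine le_trans ?_ (norm_le_coneGauge he _)
    by_contra hlt
    rw [not_le] at hlt
    have hnorm : ‖r • e + (q - v)‖ < h := by
      refine (norm_add_le _ _).trans_lt ?_
      rw [hre]; nlinarith
    refine hcone r (q - v) hr hlt.le hnorm ?_
    have : x₀ + (r • e + (q - v)) = q := by rw [hv]; abel
    rwa [this]
  refine ⟨r, hr, κ₀ * r / 3, by positivity, fun ε hε hεlt x' hx' ↦
    ⟨pullStrategy e v he, fun σII ↦ ?_⟩⟩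
  set V := barrier D x₀ e v δ M γ with hVdef
  have hV0 : ∀ z, 0 ≤ V z := barrier_nonneg he hM
  have hV1 : ∀ z, V z ≤ 1 := barrier_le_one
  have hVle : ∀ z, V z ≤ (coneGauge e (z - v) / M) ^ γ := barrier_le_rpow he hM
  have hVx : V x' ≤ ξ := by
    refine (hVle x').trans ?_
    have h1 : coneGauge e (x' - v) ≤ 6 * r := by
      refine (coneGauge_le he _).trans ?_
      have h2 : ‖x' - x₀‖ < r := by rw [← dist_eq_norm]; exact hx'.1
      have h3 : ‖x' - v‖ ≤ ‖x' - x₀‖ + ‖r • e‖ := by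
        rw [hv, ← sub_sub]; exact norm_sub_le _ _
      rw [hre] at h3
      linarith
    have h0 := coneGauge_nonneg he (x' - v)
    calc (coneGauge e (x' - v) / M) ^ γ ≤ (ξ ^ (1 / γ)) ^ γ := by
          refine Real.rpow_le_rpow (by positivity) (le_trans ?_ hrξ) hγ0.le
          gcongr
      _ = ξ := by rw [← Real.rpow_mul hξ.le, one_div_mul_cancel hγ0.ne', Real.rpow_one]
  refine le_trans (by linarith) (one_sub_le_of_barrier ε x' (pullStrategy e v he) σII hp hs hs' hε
    hD_open.measurableSet hD_bdd hx'.2 (V := V) (measurable_barrier hD_open.measurableSet) hV0 hV1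
    ?_ ?_)
  · intro z hz
    have hb : ¬ (z ∉ D ∧ z ∈ ball x₀ δ) := fun hb ↦ hz hb.2
    rw [hVdef, barrier, if_neg hb]
    refine le_min le_rfl (Real.one_le_rpow ?_ hγ0.le)
    rw [one_le_div hM]
    refine le_trans ?_ (norm_le_coneGauge he _)
    have h1 : δ ≤ ‖z - x₀‖ := by rw [← dist_eq_norm]; simpa using hz
    have h2 : ‖z - x₀‖ ≤ ‖z - v‖ + ‖r • e‖ := by
      have : z - x₀ = (z - v) + r • e := by rw [hv]; abel
      rw [this]; exact norm_add_le _ _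
    rw [hre] at h2
    linarith
  · intro n H hH
    set q := H.last
    have hG0 : 0 < coneGauge e (q - v) := lt_of_lt_of_le (by positivity) (hfar q hH)
    rw [pullStrategy_move he H hG0]
    have hVq : V q = min 1 ((coneGauge e (q - v) / M) ^ γ) := by
      rw [hVdef, barrier, if_neg fun hb ↦ hb.1 hH]
    -- Where the gauge is at least `M`, the barrier has its maximal value `1` and the inequality is
    -- trivial.
    rcases le_or_gt M (coneGauge e (q - v)) with hMG | hMG
    · have h1 : V q = 1 := by
        rw [hVq, min_eq_left (Real.one_le_rpow ((one_le_div hM).mpr hMG) hγ0.le)]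
      have h2 : ∀ g : truncCone N p 1 (e₁ N) → E N, ∫ z, V (g z) ∂jumpLaw N p s ≤ 1 := by
        intro g
        refine (integral_mono_of_nonneg (.of_forall fun z ↦ hV0 _) (integrable_const 1)
          (.of_forall fun z ↦ hV1 _)).trans ?_
        simp
      rw [h1]
      refine (add_le_add (h2 _) (h2 _)).trans (by norm_num)
    · have h1 : V q = (coneGauge e (q - v) / M) ^ γ := by
        rw [hVq, min_eq_right (Real.rpow_le_one (by positivity)
          ((div_le_one hM).mpr hMG.le) hγ0.le)]
      have hkey := integral_barrier_le hp hs hs' hκ4 hc hc0 hK hγ0 hγ1 hγ hM he hG0 hε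
        (by linarith [hfar q hH]) (U := fun z ↦ V (v + z)) (fun z ↦ hV0 _)
        (fun z ↦ by simpa using hVle (v + z)) ?_ (y' := (σII.move n H : E N)) (by simp)
      · rw [h1]
        simpa only [← add_assoc, add_sub_cancel] using hkey
      · intro z hz
        -- Seen from `x₀`, the killing ball has its centre at height `r + t / 3` on the axis; as `r
        -- ≤ M` and `t < M`, it stays within `2M` of `x₀`, below both `h` and `δ`.
        set t := coneGauge e (q - v)
        rw [mem_ball, dist_eq_norm] at hz
        set w := z - (t / 3) • e with hw
        have hw0 := norm_nonneg w
        have hvz : v + z = x₀ + ((r + t / 3) • e + w) := by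
          rw [hv, hw, add_smul]; abel
        have hnorm : ‖(r + t / 3) • e + w‖ < 2 * M := by
          refine (norm_add_le _ _).trans_lt ?_
          rw [norm_smul, he, Real.norm_of_nonneg (by positivity)]
          nlinarith
        have hout : v + z ∉ D := by
          rw [hvz]
          refine hcone _ _ (by positivity) ?_ (by linarith)
          nlinarith
        have hin : v + z ∈ ball x₀ δ := by
          rw [mem_ball, dist_eq_norm, hvz, add_sub_cancel_left]
          linarith
        rw [hVdef, barrier, if_pos ⟨hout, hin⟩]

end TugOfWar

end

theorem theorem8p4 (N : ℕ) [N.AtLeastTwo] (p s : ℝ) (hp : 2 ≤ p) (hs : 1 / 2 < s) (hs' : s < 1)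
    (D : Set (TugOfWar.E N)) (hD_open : IsOpen D) (hD_bdd : Bornology.IsBounded D)
    (hD_cone : TugOfWar.ExteriorConeCondition D) :
    ∀ x ∈ frontier D, TugOfWar.GameRegular p s D x := by
  intro x hx
  obtain ⟨β, hβ, h, hh, hcone⟩ := hD_cone
  obtain ⟨S, -, hS⟩ := hcone x hx
  obtain ⟨κ, hκ0, hκ4, hκ⟩ :=
    TugOfWar.exists_forall_angle_add_lt (F := TugOfWar.E N) hβ
  have he : ‖S (TugOfWar.e₁ N)‖ = 1 := by rw [S.norm_map, TugOfWar.norm_e₁]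
  refine TugOfWar.gameRegular_of_exteriorCone hp hs hs' hD_open hD_bdd he hκ0 hκ4 hh
    fun r w hr hw hnorm ↦ ?_
  have hz : S (r • TugOfWar.e₁ N + S.symm w) = r • S (TugOfWar.e₁ N) + w := by simp
  rw [← hz]
  refine hS _ ⟨hκ _ _ r (TugOfWar.norm_e₁ N) hr (by rwa [S.symm.norm_map]), ?_, ?_⟩
  · rw [← S.norm_map, hz]
    have h1 := norm_sub_norm_le (r • S (TugOfWar.e₁ N)) (-w)
    rw [sub_neg_eq_add, norm_neg, norm_smul, he, Real.norm_of_nonneg hr.le] at h1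
    nlinarith
  · rwa [← S.norm_map, hz]
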